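/- **Theorem (Moniqua on $D^2$).** Let $n\ge 2$ workers minimize $f=\frac1n\sum_{i=1}^n f_i$ over $\mathbb{R}^d$, where $f$ is bounded below. Assume: 1. every $f_i$ is differentiable and $\nabla f_i$ is $L$-Lipschitz, $L>0$; 2. $W\in\mathbb{R}^{n\times n}$ is symmetric and doubly stochastic, with eigenvalues $\lambda_1\ge\lambda_2\ge\dots\ge\lambda_n$ satisfying $\lambda_2<1$ and $\lambda_n>-\frac13$; 3. in iteration $k$ worker $i$ samples $\xi_{k,i}\sim\mathcal D_i$, independently over the workers and of all previous iterations, and its stochastic gradient is unbiased with variance at most $\sigma^2$: for all $x$, $\mathbb{E}_{\xi\sim\mathcal D_i}\nabla\tilde f_i(x;\xi)=\nabla f_i(x)$ and $\mathbb{E}_{\xi\sim\mathcal D_i}\|\nabla\tilde f_i(x;\xi)-\nabla f_i(x)\|^2\le\sigma^2$; 4. $x_{0,i}=0$ for all $i$; 5. the sampled gradients $\tilde g_{k,i}=\nabla\tilde f_i(x_{k,i};\xi_{k,i})$, $0\le k<K$, satisfy $\|\tilde g_{k,i}\|_\infty\le G_\infty$ almost surely, for a constant $G_\infty>0$. Put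 $v_n=\lambda_n-\sqrt{\lambda_n^2-\lambda_n}$ (a complex number if $0<\lambda_n<1$) and $$D_1=\max\Big\{|v_n|+\tfrac{2|\lambda_n|}{1-|v_n|},\ \sqrt{\tfrac{\lambda_2}{1-\lambda_2}}+\tfrac{2\lambda_2}{1-\lambda_2}\Big\},\qquad D_2=\max\Big\{\tfrac{2}{1-|v_n|},\ \tfrac{2}{\sqrt{1-\lambda_2}}\Big\}$$ (the second entry of $D_1$ is dropped if $\lambda_2<0$), and, for $K\ge1$, $$\delta=\frac1{12nD_2+2},\quad \alpha=\frac1{\sigma\sqrt{K/n}+2L},\quad \theta=(6D_1n+8)\,\alpha\,G_\infty,\quad B_\theta=\frac{2\theta}{1-2\delta}.$$ For $a>0$ let $z\bmod a$ be the representative of $z$ modulo $a$ in $[-\frac a2,\frac a2)$, taken coordinatewise for vectors. Let $\mathcal Q_\delta$ be a (possibly randomized) quantizer with $\|\mathcal Q_\delta(z)-z\|_\infty\le\delta$ for all $z\in[-\frac12,\frac12)^d$; its random seeds in an iteration are independent of all other iterations, and otherwise arbitrary. For $k=0,\dots,K-1$ every worker $i$ computes $$x_{k+\frac12,i}=\begin{cases}x_{0,i}-\alpha\tilde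 g_{0,i}, & k=0,\\ 2x_{k,i}-x_{k-1,i}-\alpha\tilde g_{k,i}+\alpha\tilde g_{k-1,i}, & k\ge1,\end{cases}$$ sends $q_{k+\frac12,i}=\mathcal Q_\delta\big(\tfrac{x_{k+1/2,i}}{B_\theta}\bmod 1\big)$ to its neighbors $\mathcal N_i=\{j\ne i: W_{ji}\neq0\}$, and, with $$\hat x^{(i)}_{k+\frac12,i}=q_{k+\frac12,i}B_\theta-(x_{k+\frac12,i}\bmod B_\theta)+x_{k+\frac12,i},\qquad \hat x^{(i)}_{k+\frac12,j}=\big(q_{k+\frac12,j}B_\theta-x_{k+\frac12,i}\big)\bmod B_\theta+x_{k+\frac12,i}\quad(j\in\mathcal N_i),$$ sets $$x_{k+1,i}=x_{k+\frac12,i}+\sum_{j\in\mathcal N_i}\big(\hat x^{(i)}_{k+\frac12,j}-\hat x^{(i)}_{k+\frac12,i}\big)W_{ji}.$$ Then $\overline X_k=\frac1n\sum_{i=1}^n x_{k,i}$ satisfies $$\frac1K\sum_{k=0}^{K-1}\mathbb{E}\big\|\nabla f(\overline X_k)\big\|^2\ \le\ C\left(\frac1K+\frac{\sigma}{\sqrt{nK}}+\frac{\sigma^2n}{\sigma^2K+n}+\frac{G_\infty^2\,d\,n}{\sigma^2K+n}\right),$$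 where all the expectations are finite and $C>0$ depends only on $L$, $\lambda_2$, $\lambda_n$ and (an upper bound for) $f(0)-\inf f$; in particular $C$ does not depend on $n$, $d$, $K$, $\sigma$, $G_\infty$. -/

import Mathlib

open MeasureTheory ProbabilityTheory
open scoped BigOperators

noncomputable section

namespace MoniquaD2

/-- The parameter space `ℝ^d` with its Euclidean norm. -/
abbrev Model (d : ℕ) : Type := EuclideanSpace ℝ (Fin d)

/-! ### The communication matrix and its constants -/

theorem isHermitian_of_isSymm {n : ℕ} {W : Matrix (Fin n) (Fin n) ℝ} (hW : W.IsSymm) :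
    W.IsHermitian := by
  rw [Matrix.IsHermitian, Matrix.conjTranspose_eq_transpose_of_trivial]
  exact hW

/-- The eigenvalues of a real symmetric matrix, with multiplicity, in decreasing order;
index `0` is the largest one. -/
def sortedEigenvalue {n : ℕ} {W : Matrix (Fin n) (Fin n) ℝ} (hW : W.IsSymm) (i : Fin n) : ℝ :=
  (isHermitian_of_isSymm hW).eigenvalues₀ (Fin.cast (Fintype.card_fin n).symm i)

/-- `|v|` for `v = μ - √(μ² - μ)`; the square root is the principal complex one, because
`μ² - μ` is negative for `0 < μ < 1`. -/
def vAbs (μ : ℝ) : ℝ :=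
  ‖(μ : ℂ) - ((μ ^ 2 - μ : ℝ) : ℂ) ^ (1 / 2 : ℂ)‖

/-- `D₁` as a function of the second largest and the smallest eigenvalue. If `lam2 < 0`, the second
entry is negative (the real square root is then `0`) and the first one, which is nonnegative, is
the maximum. -/
def D₁ (lam2 lamn : ℝ) : ℝ :=
  max (vAbs lamn + 2 * |lamn| / (1 - vAbs lamn))
    (Real.sqrt (lam2 / (1 - lam2)) + 2 * lam2 / (1 - lam2))

/-- `D₂` as a function of the second largest and the smallest eigenvalue. -/
def D₂ (lam2 lamn : ℝ) : ℝ :=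
  max (2 / (1 - vAbs lamn)) (2 / Real.sqrt (1 - lam2))

/-- The quantization accuracy `δ = 1 / (12 n D₂ + 2)`. -/
def accuracy (n : ℕ) (lam2 lamn : ℝ) : ℝ :=
  1 / (12 * n * D₂ lam2 lamn + 2)

/-- The step size `α = 1 / (σ √(K/n) + 2 L)`. -/
def stepSize (n K : ℕ) (σ L : ℝ) : ℝ :=
  1 / (σ * Real.sqrt (K / n) + 2 * L)

/-- The discrepancy bound `θ = (6 D₁ n + 8) α G`. -/
def theta (n : ℕ) (lam2 lamn α G : ℝ) : ℝ :=
  (6 * D₁ lam2 lamn * n + 8) * α * G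

/-- The modulus `B_θ = 2 θ / (1 - 2 δ)`. -/
def modulus (θ δ : ℝ) : ℝ :=
  2 * θ / (1 - 2 * δ)

/-! ### Modulo-quantized communication -/

/-- For `a > 0`: the representative of `z` modulo `a` in `[-a/2, a/2)`. -/
def cmod (z a : ℝ) : ℝ :=
  z - a * ⌊z / a + 1 / 2⌋

/-- The coordinatewise centred modulo operation. -/
def vmod {d : ℕ} (x : Model d) (a : ℝ) : Model d :=
  WithLp.toLp 2 fun c => cmod (x c) a

/-- `Q` has accuracy `δ`: every coordinate of every point of the cell `[-1/2, 1/2)^d` is reproduced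
up to an error of at most `δ`. -/
def IsQuantizer {d : ℕ} (δ : ℝ) (Q : Model d → Model d) : Prop :=
  ∀ z : Model d, (∀ c, z c ∈ Set.Ico (-(1 / 2) : ℝ) (1 / 2)) → ∀ c, |Q z c - z c| ≤ δ

/-- The message `Q((h / B) mod 1)` that a worker with intermediate model `h` sends. -/
def message {d : ℕ} (Q : Model d → Model d) (B : ℝ) (h : Model d) : Model d :=
  Q (vmod (B⁻¹ • h) 1)

/-- The worker's own biased term `q B - h mod B + h`, for its own message `q`. -/
def selfTerm {d : ℕ} (B : ℝ) (q h : Model d) : Model d :=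
  B • q - vmod h B + h

/-- The neighbour's model that a worker with intermediate model `h` recovers from the message `q`:
`(q B - h) mod B + h`. -/
def recovered {d : ℕ} (B : ℝ) (q h : Model d) : Model d :=
  vmod (B • q - h) B + h

open scoped Classical in
/-- The neighbour list of worker `i`. -/
def neighbors {n : ℕ} (W : Matrix (Fin n) (Fin n) ℝ) (i : Fin n) : Finset (Fin n) :=
  Finset.univ.filter fun j => j ≠ i ∧ W j i ≠ 0

/-- One round of communication: from the intermediate models `h i` to the next models. `Q i` is the
quantizer that worker `i` uses in this round. -/
def communicate {n d : ℕ} (W : Matrix (Fin n) (Fin n) ℝ) (B : ℝ)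
    (Q : Fin n → Model d → Model d) (h : Fin n → Model d) (i : Fin n) : Model d :=
  h i + ∑ j ∈ neighbors W i,
    W j i • (recovered B (message (Q j) B (h j)) (h i) - selfTerm B (message (Q i) B (h i)) (h i))

/-- The models `x_{k,i}` of Moniqua on D², started at `0`, along one realization of the data samples
`s k i` and of the quantizer seeds `u k i`. The sampled gradient of worker `i` in iteration `k` is
`g i (x_{k,i}) (s k i)`; a quantizer with seed `u` is the map `Q u`. -/
def iterates {n d : ℕ} {Ξ U : Type*} (W : Matrix (Fin n) (Fin n) ℝ) (B α : ℝ)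
    (g : Fin n → Model d → Ξ → Model d) (Q : U → Model d → Model d)
    (s : ℕ → Fin n → Ξ) (u : ℕ → Fin n → U) : ℕ → Fin n → Model d
  | 0 => fun _ => 0
  | 1 =>
    let x := iterates W B α g Q s u 0
    communicate W B (fun i => Q (u 0 i)) fun i => x i - α • g i (x i) (s 0 i)
  | k + 2 =>
    let x := iterates W B α g Q s u (k + 1)
    let y := iterates W B α g Q s u k
    communicate W B (fun i => Q (u (k + 1) i)) fun i =>
      (2 : ℝ) • x i - y i - α • g i (x i) (s (k + 1) i) + α • g i (y i) (s k i)

/-- The average of the workers' models. -/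
def average {n d : ℕ} (x : Fin n → Model d) : Model d :=
  (n : ℝ)⁻¹ • ∑ i, x i

/-! ### The optimization problem and its sampling -/

/-- The global objective `f = (1/n) ∑ f_i`. -/
def objective {n d : ℕ} (f : Fin n → Model d → ℝ) (x : Model d) : ℝ :=
  (n : ℝ)⁻¹ * ∑ i, f i x

/-- `f` is differentiable with `L`-Lipschitz gradient. -/
def IsSmooth {d : ℕ} (L : ℝ) (f : Model d → ℝ) : Prop :=
  Differentiable ℝ f ∧ ∀ x y, ‖gradient f x - gradient f y‖ ≤ L * ‖x - y‖

/-- `g x ξ`, with `ξ` of law `D`, is an unbiased estimate of the gradient of `f` at `x`, with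
variance at most `σ²`, for every `x`. -/
structure IsStochasticGradient {d : ℕ} {Ξ : Type*} [MeasurableSpace Ξ] (D : Measure Ξ) (σ : ℝ)
    (f : Model d → ℝ) (g : Model d → Ξ → Model d) : Prop where
  measurable : Measurable fun p : Model d × Ξ => g p.1 p.2
  integrable : ∀ x, Integrable (g x) D
  unbiased : ∀ x, ∫ ξ, g x ξ ∂D = gradient f x
  variance_le : ∀ x,
    ∫⁻ ξ, ENNReal.ofReal (‖g x ξ - gradient f x‖ ^ 2) ∂D ≤ ENNReal.ofReal (σ ^ 2)

/-- Sampling of the data `ξ k i` (worker `i`, iteration `k`) with law `D i` and of the quantizer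
seeds `u k i`. Different iterations are independent, and within an iteration the data of different
workers are independent; the seeds of one iteration may be constant, shared between workers, or
otherwise dependent. -/
structure IsSampling {n : ℕ} {Ω Ξ U : Type*} [MeasurableSpace Ω] [MeasurableSpace Ξ]
    [MeasurableSpace U] (P : Measure Ω) (D : Fin n → Measure Ξ)
    (ξ : ℕ → Fin n → Ω → Ξ) (u : ℕ → Fin n → Ω → U) : Prop where
  measurable_data : ∀ k i, Measurable (ξ k i)
  measurable_seed : ∀ k i, Measurable (u k i)
  law : ∀ k i, P.map (ξ k i) = D i
  indep_iterations : iIndepFun (fun (k : ℕ) (ω : Ω) (i : Fin n) => (ξ k i ω, u k i ω)) P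
  indep_workers : ∀ k, iIndepFun (ξ k) P

end MoniquaD2

end

namespace MoniquaD2

/-! ### The constants `|v_n|`, `D₁` and `D₂` -/

/-! As long as the intermediate models of any two workers differ by less than θ in every coordinate,
decoding modulo `B_θ` is exact: the receiver obtains precisely the biased term that the sender
computes for itself (`recovered_eq_selfTerm`). A round is then linear up to the quantization error
e, bounded coordinatewise by `B_θ δ`: the vector of workers' values goes from h to W(h + e) - e
(`communicate_apply`). That the workers do stay within θ is proved along each realization with
bounded sampled gradients, by strong induction on the iteration (`abs_intermediate_sub_lt`).

For the induction step, each coordinate is expanded in an orthonormal eigenbasis of W. A mode with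
eigenvalue λ obeys y(k+2) = λ(2y(k+1) - y(k)) + f(k), where f collects a gradient difference and a
quantization error. Solving for the extrapolation 2y(k+1) - y(k) gives convolutions with
`diffImpulse` and `impulse`. For λ ≥ 0 a quadratic form that is multiplied by λ at every step
(`impulse_invariant`) controls these responses; for λ < 0 a positive majorant does, and it is
summable because λ_n > -1/3. Cauchy–Schwarz is applied with time weights that do not depend on λ
(`exists_weight_diffImpulse`, `exists_weight_impulse`), so the sums over modes and times can be
exchanged and Parseval used at each time. The resulting bound `dispersion_extrapolation_le` closes
the induction by the choice of θ and δ. It also keeps the models within O(αG) of their average, in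
root mean square over the workers and per coordinate, with a constant free of n.

The errors cancel in the average, because W is doubly stochastic, so the average performs plain SGD
with gradients taken at the individual models (`average_succ`). The usual descent argument applies:
consensus controls the gradient mismatch, and independence removes the terms linear in the noise and
divides the variance by n (`integral_objective_step_le`). Telescoping and inserting α give the rate
(`rate_le`). -/

theorem vAbs_nonneg (μ : ℝ) : 0 ≤ vAbs μ := norm_nonneg _

theorem vAbs_of_nonpos {μ : ℝ} (hμ : μ ≤ 0) : vAbs μ = -μ + Real.sqrt (μ ^ 2 - μ) := by
  have h0 : 0 ≤ μ ^ 2 - μ := by nlinarith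
  have h1 : (((μ ^ 2 - μ : ℝ) : ℂ)) ^ (1 / 2 : ℂ) = ((Real.sqrt (μ ^ 2 - μ) : ℝ) : ℂ) := by
    rw [Real.sqrt_eq_rpow, Complex.ofReal_cpow h0]
    norm_num
  rw [vAbs, h1, ← Complex.ofReal_sub, Complex.norm_real, Real.norm_eq_abs, abs_of_nonpos]
  · ring
  · have := Real.sqrt_nonneg (μ ^ 2 - μ)
    linarith

/-- The square root of the nonpositive number μ² - μ is purely imaginary, so the squared modulus is
μ² + (μ - μ²) = μ. -/
theorem vAbs_of_nonneg {μ : ℝ} (h0 : 0 ≤ μ) (h1 : μ ≤ 1) : vAbs μ = Real.sqrt μ := by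
  have hx : μ ^ 2 - μ ≤ 0 := by nlinarith
  set z : ℂ := (((μ ^ 2 - μ : ℝ) : ℂ)) ^ (1 / 2 : ℂ) with hz
  have hzz : z * z = ((μ ^ 2 - μ : ℝ) : ℂ) := by
    rw [← pow_two, hz]
    simp
  have hre : z.re * z.re - z.im * z.im = μ ^ 2 - μ := by
    have := congrArg Complex.re hzz
    rwa [Complex.mul_re, Complex.ofReal_re] at this
  have him : z.re * z.im + z.im * z.re = 0 := by
    have := congrArg Complex.im hzz
    rwa [Complex.mul_im, Complex.ofReal_im] at this
  have hre0 : z.re = 0 := by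
    have h : z.re * z.im = 0 := by linarith
    rcases mul_eq_zero.1 h with h | h
    · exact h
    · rw [h] at hre
      nlinarith [mul_self_nonneg z.re]
  rw [hre0] at hre
  have hn : vAbs μ = ‖(μ : ℂ) - z‖ := rfl
  rw [hn, Complex.norm_def, Complex.normSq_apply]
  simp only [Complex.sub_re, Complex.sub_im, Complex.ofReal_re, Complex.ofReal_im, hre0]
  congr 1
  nlinarith

/-- With a the modulus and l = -μ this is the characteristic equation a² = l(1 + 2a). It lets l be
eliminated in favour of a below, and it shows that a < 1 exactly when l < 1/3. -/
theorem vAbs_sq_of_nonpos {μ : ℝ} (hμ : μ ≤ 0) : vAbs μ ^ 2 = -μ * (1 + 2 * vAbs μ) := by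
  have h0 : 0 ≤ μ ^ 2 - μ := by nlinarith
  have := Real.sq_sqrt h0
  rw [vAbs_of_nonpos hμ]
  nlinarith

theorem vAbs_lt_one {μ : ℝ} (h0 : -(1 / 3) < μ) (h1 : μ < 1) : vAbs μ < 1 := by
  rcases le_total 0 μ with h | h
  · rw [vAbs_of_nonneg h h1.le, Real.sqrt_lt' one_pos]
    simpa using h1
  · have h2 := vAbs_sq_of_nonpos h
    have h3 := vAbs_nonneg μ
    nlinarith

section Constants

variable {lam2 lamn : ℝ} (h2 : lam2 < 1) (hn : -(1 / 3) < lamn) (hle : lamn ≤ lam2)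

include h2 hn hle

theorem D₁_nonneg : 0 ≤ D₁ lam2 lamn := by
  have ha := vAbs_lt_one hn (hle.trans_lt h2)
  have ha0 := vAbs_nonneg lamn
  refine le_max_of_le_left ?_
  have : 0 ≤ 2 * |lamn| / (1 - vAbs lamn) := div_nonneg (by positivity) (by linarith)
  linarith

theorem two_le_D₂ : 2 ≤ D₂ lam2 lamn := by
  have ha := vAbs_lt_one hn (hle.trans_lt h2)
  have ha0 := vAbs_nonneg lamn
  refine le_max_of_le_left ?_
  rw [le_div_iff₀ (by linarith)]
  linarith

/-- The left side bounds the total mass of the weights for nonnegative eigenvalues in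
`exists_weight_diffImpulse`: 2m at time 0 and the geometric tail of ratio √m, where m is the
positive part of `lam2`. -/
theorem gradient_sum_pos_le :
    2 * max lam2 0 + Real.sqrt (max lam2 0) / (1 - Real.sqrt (max lam2 0))
      ≤ 7 / 4 * D₁ lam2 lamn := by
  rcases le_total lam2 0 with h | h
  · rw [max_eq_right h]
    simpa using D₁_nonneg h2 hn hle
  · rw [max_eq_left h]
    have hD : Real.sqrt (lam2 / (1 - lam2)) + 2 * lam2 / (1 - lam2) ≤ D₁ lam2 lamn :=
      le_max_right _ _
    refine le_trans ?_ (mul_le_mul_of_nonneg_left hD (by norm_num))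
    rw [Real.sqrt_div h]
    set s := Real.sqrt lam2 with hs
    set c := Real.sqrt (1 - lam2) with hc
    have hs0 : 0 ≤ s := Real.sqrt_nonneg _
    have hc0 : 0 < c := Real.sqrt_pos.2 (by linarith)
    have hs2 : s ^ 2 = lam2 := Real.sq_sqrt h
    have hc2 : c ^ 2 = 1 - lam2 := Real.sq_sqrt (by linarith)
    have hs1 : s < 1 := by nlinarith
    have hc1 : c ≤ 1 := by nlinarith
    have e1 : s / (1 - s) = (s + s ^ 2) / c ^ 2 := by
      rw [div_eq_div_iff (by linarith) (by positivity), hc2, ← hs2]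
      ring
    rw [e1, ← hc2, ← hs2]
    have e2 : 7 / 4 * (s / c + 2 * s ^ 2 / c ^ 2)
        = (7 / 4 * (s * c + 2 * s ^ 2)) / c ^ 2 := by
      field_simp
    have e3 : 2 * s ^ 2 + (s + s ^ 2) / c ^ 2 = (2 * s ^ 2 * c ^ 2 + (s + s ^ 2)) / c ^ 2 := by
      field_simp
    rw [e2, e3]
    refine div_le_div_of_nonneg_right ?_ (by positivity)
    -- The claim multiplied by c² and divided by s; it is multiplied by s again at the end, so s = 0
    -- needs no separate case.
    have key : 1 + 2 * s * c ^ 2 ≤ 7 / 4 * c + 5 / 2 * s := by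
      have hcc : c ^ 2 ≤ c := by nlinarith
      have hc2' : c ^ 2 = 1 - s ^ 2 := by rw [hc2, hs2]
      nlinarith [mul_nonneg hs0 (sq_nonneg (s - 1 / 2)), sq_nonneg (s - 1 / 2)]
    nlinarith [mul_le_mul_of_nonneg_left key hs0]

/-- The counterpart for negative eigenvalues: l times two copies of the mass bound 3 / (1 - 3l) of
`negImpulse`, with l the negative part of `lamn`. -/
theorem gradient_sum_neg_le :
    6 * max (-lamn) 0 / (1 - 3 * max (-lamn) 0) ≤ 9 / 4 * D₁ lam2 lamn := by
  rcases le_total 0 lamn with h | h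
  · rw [max_eq_right (by linarith)]
    simpa using D₁_nonneg h2 hn hle
  · rw [max_eq_left (by linarith)]
    have hD : vAbs lamn + 2 * |lamn| / (1 - vAbs lamn) ≤ D₁ lam2 lamn := le_max_left _ _
    refine le_trans ?_ (mul_le_mul_of_nonneg_left hD (by norm_num))
    have ha1 := vAbs_lt_one hn (hle.trans_lt h2)
    have ha0 := vAbs_nonneg lamn
    have hsq := vAbs_sq_of_nonpos h
    rw [abs_of_nonpos h]
    generalize vAbs lamn = a at *
    obtain ⟨l, rfl⟩ : ∃ l, lamn = -l := ⟨-lamn, by ring⟩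
    simp only [neg_neg] at *
    -- A rewriting of a² = l(1 + 2a), by which 1 - 3l and 1 - a vanish together; both sides thus
    -- have the same singularity and only a polynomial inequality on [0, 1) remains.
    have hp : (1 - 3 * l) * (1 + 2 * a) = (1 - a) * (1 + 3 * a) := by nlinarith
    have e1 : 6 * l / (1 - 3 * l) = 6 * a ^ 2 / ((1 - a) * (1 + 3 * a)) := by
      rw [div_eq_div_iff (by linarith) (by nlinarith), hsq, ← hp]
      ring
    have e2 : 2 * l / (1 - a) = 2 * a ^ 2 / ((1 - a) * (1 + 2 * a)) := by
      rw [div_eq_div_iff (by linarith) (by nlinarith), hsq]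
      ring
    have e3 : a + 2 * a ^ 2 / ((1 - a) * (1 + 2 * a))
        = a * (1 + 3 * a - 2 * a ^ 2) / ((1 - a) * (1 + 2 * a)) := by
      have : 1 - a ≠ 0 := by linarith
      have : 1 + 2 * a ≠ 0 := by linarith
      field_simp
      ring
    have hpos : 0 < 1 - a := by linarith
    rw [e1, e2, e3, ← mul_div_assoc, div_le_div_iff₀ (by positivity) (by positivity)]
    have h3 : a ^ 3 ≤ 1 := pow_le_one₀ ha0 ha1.le
    have h32 : a ^ 3 ≤ a ^ 2 := pow_le_pow_of_le_one ha0 ha1.le (by norm_num)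
    have h31 : a ^ 3 ≤ a := by simpa using pow_le_pow_of_le_one ha0 ha1.le (show 1 ≤ 3 by norm_num)
    have key : 6 * a * (1 + 2 * a) ≤ 9 / 4 * ((1 + 3 * a - 2 * a ^ 2) * (1 + 3 * a)) := by
      nlinarith
    have := mul_le_mul_of_nonneg_left key (mul_nonneg ha0 hpos.le)
    nlinarith

theorem quantization_sum_pos_le :
    2 + 2 / Real.sqrt (1 - max lam2 0) ≤ 2 * D₂ lam2 lamn := by
  have h := two_le_D₂ h2 hn hle
  have h' : 2 / Real.sqrt (1 - max lam2 0) ≤ D₂ lam2 lamn := by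
    rcases le_total lam2 0 with h0 | h0
    · rw [max_eq_right h0]
      simpa using h
    · rw [max_eq_left h0]
      exact le_max_right _ _
  linarith

theorem quantization_sum_neg_le :
    (1 + max (-lamn) 0) * (3 / (1 - 3 * max (-lamn) 0)) ≤ 3 / 2 * D₂ lam2 lamn := by
  rcases le_total 0 lamn with h | h
  · rw [max_eq_right (by linarith)]
    have := two_le_D₂ h2 hn hle
    norm_num
    linarith
  · rw [max_eq_left (by linarith)]
    have hD : 2 / (1 - vAbs lamn) ≤ D₂ lam2 lamn := le_max_left _ _
    refine le_trans ?_ (mul_le_mul_of_nonneg_left hD (by norm_num))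
    have ha1 := vAbs_lt_one hn (hle.trans_lt h2)
    have ha0 := vAbs_nonneg lamn
    have hsq := vAbs_sq_of_nonpos h
    generalize vAbs lamn = a at *
    obtain ⟨l, rfl⟩ : ∃ l, lamn = -l := ⟨-lamn, by ring⟩
    simp only [neg_neg] at *
    have hp : (1 - 3 * l) * (1 + 2 * a) = (1 - a) * (1 + 3 * a) := by nlinarith
    have e : 3 / 2 * (2 / (1 - a)) = 3 / (1 - a) := by ring
    rw [e, ← mul_div_assoc, div_le_div_iff₀ (by linarith) (by linarith)]
    -- Since (1 + l)(1 + 2a) = (1 + a)², this reduces to a² ≤ a.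
    have : (1 + l) * (1 - a) * (1 + 2 * a) ≤ (1 - 3 * l) * (1 + 2 * a) := by
      rw [hp]
      nlinarith [mul_nonneg ha0 (sub_nonneg.2 ha1.le),
        mul_nonneg (mul_nonneg ha0 (sub_nonneg.2 ha1.le)) (sub_nonneg.2 ha1.le)]
    have := le_of_mul_le_mul_right this (by linarith)
    linarith

end Constants

/-! ### The scalar recurrence `z (t + 2) = 2 λ z (t + 1) - λ z t` -/

/-- The response of `2 y (k + 1) - y k` to an impulse in
`y (k + 2) = 2 λ y (k + 1) - λ y k + f k`. -/
def impulse (lam : ℝ) : ℕ → ℝ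
  | 0 => 2
  | 1 => 4 * lam - 1
  | t + 2 => 2 * lam * impulse lam (t + 1) - lam * impulse lam t

/-- The response to an impulse in `f k = λ (γ (k + 1) - γ k)`. -/
def diffImpulse (lam : ℝ) : ℕ → ℝ
  | 0 => 2 * lam
  | t + 1 => lam * (impulse lam (t + 1) - impulse lam t)

theorem impulse_add_two (lam : ℝ) (t : ℕ) :
    impulse lam (t + 2) = 2 * lam * impulse lam (t + 1) - lam * impulse lam t := by
  rw [impulse]

/-- The form x² - 2λxy + λy² is multiplied by λ, the product of the characteristic roots, at each
step, and the initial values make it 1. For 0 ≤ λ ≤ 1 it equals the sum of nonnegative terms (1 -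
λ)x² + λ(x - y)², which yields decay estimates without solving for complex or double roots. -/
theorem impulse_invariant (lam : ℝ) (t : ℕ) :
    impulse lam (t + 1) ^ 2 - 2 * lam * impulse lam (t + 1) * impulse lam t
      + lam * impulse lam t ^ 2 = lam ^ t := by
  induction t with
  | zero => simp only [impulse]; ring
  | succ t ih =>
    rw [impulse_add_two, pow_succ lam, ← ih]
    ring

theorem one_sub_mul_impulse_sq_le {lam : ℝ} (h : 0 ≤ lam) (t : ℕ) :
    (1 - lam) * impulse lam (t + 1) ^ 2 ≤ lam ^ t := by
  rw [← impulse_invariant lam t]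
  nlinarith [mul_nonneg h (sq_nonneg (impulse lam (t + 1) - impulse lam t))]

theorem diffImpulse_sq_le {lam : ℝ} (h : 0 ≤ lam) (h1 : lam ≤ 1) (t : ℕ) :
    diffImpulse lam (t + 1) ^ 2 ≤ lam ^ (t + 1) := by
  rw [diffImpulse, pow_succ lam t, ← impulse_invariant lam t]
  nlinarith [mul_nonneg h (mul_nonneg (sub_nonneg.2 h1) (sq_nonneg (impulse lam (t + 1))))]

/-- A bound for `|impulse λ|` on `-l ≤ λ ≤ 0`. -/
def negImpulse (l : ℝ) : ℕ → ℝ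
  | 0 => 2
  | 1 => 4 * l + 1
  | t + 2 => 2 * l * negImpulse l (t + 1) + l * negImpulse l t

theorem negImpulse_nonneg {l : ℝ} (hl : 0 ≤ l) : ∀ t, 0 ≤ negImpulse l t
  | 0 => by norm_num [negImpulse]
  | 1 => by rw [negImpulse]; positivity
  | t + 2 => by
    have := negImpulse_nonneg hl t
    have := negImpulse_nonneg hl (t + 1)
    rw [negImpulse]
    positivity

theorem abs_impulse_le {l lam : ℝ} (h0 : -l ≤ lam) (h1 : lam ≤ 0) :
    ∀ t, |impulse lam t| ≤ negImpulse l t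
  | 0 => by norm_num [impulse, negImpulse]
  | 1 => by
    rw [impulse, negImpulse, abs_le]
    constructor <;> linarith
  | t + 2 => by
    have hl : |lam| ≤ l := abs_le.2 ⟨h0, by linarith⟩
    have i0 := abs_impulse_le h0 h1 t
    have i1 := abs_impulse_le h0 h1 (t + 1)
    rw [impulse, negImpulse]
    refine (abs_sub _ _).trans ?_
    rw [abs_mul, abs_mul, abs_mul, abs_two]
    have hl0 : 0 ≤ l := (abs_nonneg lam).trans hl
    have hl2 : 0 ≤ 2 * l := by positivity
    gcongr

/-- The partial sums satisfy S(k+2) = 3 + 2l S(k+1) + l S(k), whose fixed point is 3 / (1 - 3l);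
induction keeps them below it. -/
theorem sum_negImpulse_le {l : ℝ} (hl : 0 ≤ l) (hl' : l < 1 / 3) :
    ∀ k, ∑ t ∈ Finset.range k, negImpulse l t ≤ 3 / (1 - 3 * l)
  | 0 => by
    rw [Finset.sum_range_zero]
    exact div_nonneg (by norm_num) (by linarith)
  | 1 => by
    rw [Finset.sum_range_one, negImpulse, le_div_iff₀ (by linarith)]
    linarith
  | k + 2 => by
    have i0 := sum_negImpulse_le hl hl' k
    have i1 := sum_negImpulse_le hl hl' (k + 1)
    have e : ∑ t ∈ Finset.range (k + 2), negImpulse l t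
        = 3 + 2 * l * ∑ t ∈ Finset.range (k + 1), negImpulse l t
          + l * ∑ t ∈ Finset.range k, negImpulse l t := by
      rw [Finset.sum_range_succ', Finset.sum_range_succ', Finset.sum_range_succ' _ k]
      simp only [negImpulse, Finset.sum_add_distrib, ← Finset.mul_sum]
      ring
    rw [e]
    have e' : 3 / (1 - 3 * l) = 3 + 2 * l * (3 / (1 - 3 * l)) + l * (3 / (1 - 3 * l)) := by
      have : 1 - 3 * l ≠ 0 := by linarith
      field_simp
      ring
    rw [e']
    gcongr

/-- Duhamel's formula. The recurrence is assumed only below K, since in the induction over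
iterations it is known only for the rounds already shown to decode correctly. -/
theorem convolution_impulse (lam : ℝ) (f Y : ℕ → ℝ) (h0 : Y 0 = 0) (h1 : Y 1 = 0) (K : ℕ)
    (hY : ∀ k < K, Y (k + 2) = lam * (2 * Y (k + 1) - Y k) + f k) :
    ∀ k ≤ K, 2 * Y (k + 1) - Y k = ∑ t ∈ Finset.range k, impulse lam t * f (k - 1 - t)
  | 0, _ => by simp [h0, h1]
  | 1, hk => by
    rw [hY 0 hk, h0, h1]
    simp [impulse]
  | k + 2, hk => by
    have i0 := convolution_impulse lam f Y h0 h1 K hY k (by omega)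
    have i1 := convolution_impulse lam f Y h0 h1 K hY (k + 1) (by omega)
    have r0 := hY (k + 1) (by omega)
    have r1 := hY k (by omega)
    rw [Finset.sum_range_succ'] at i1
    rw [Finset.sum_range_succ', Finset.sum_range_succ']
    have e1 : ∀ t ∈ Finset.range k, impulse lam (t + 1) * f (k + 1 - 1 - (t + 1))
        = impulse lam (t + 1) * f (k - 1 - t) := fun t _ => by
      rw [show k + 1 - 1 - (t + 1) = k - 1 - t by omega]
    have e2 : ∀ t ∈ Finset.range k, impulse lam (t + 1 + 1) * f (k + 2 - 1 - (t + 1 + 1))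
        = 2 * lam * (impulse lam (t + 1) * f (k - 1 - t))
          - lam * (impulse lam t * f (k - 1 - t)) := fun t _ => by
      rw [show k + 2 - 1 - (t + 1 + 1) = k - 1 - t by omega, impulse_add_two]
      ring
    rw [Finset.sum_congr rfl e1] at i1
    rw [Finset.sum_congr rfl e2, Finset.sum_sub_distrib, ← Finset.mul_sum, ← Finset.mul_sum, ← i0]
    simp only [impulse, Nat.sub_zero, Nat.add_sub_cancel, zero_add,
      show k + 2 - 1 = k + 1 by omega] at i1 ⊢
    linear_combination r0 * 2 - r1 + 2 * lam * i1

/-- Summation by parts moves the difference from the gradients to the response; the boundary term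
vanishes because Γ starts at 0. -/
theorem sum_impulse_mul_sub (lam : ℝ) (Γ : ℕ → ℝ) (h0 : Γ 0 = 0) (k : ℕ) :
    ∑ t ∈ Finset.range k, impulse lam t * (lam * (Γ (k - 1 - t + 1) - Γ (k - 1 - t)))
      = ∑ t ∈ Finset.range k, diffImpulse lam t * Γ (k - t) := by
  cases k with
  | zero => simp
  | succ k =>
    have e : ∀ t ∈ Finset.range (k + 1),
        impulse lam t * (lam * (Γ (k + 1 - 1 - t + 1) - Γ (k + 1 - 1 - t)))
          = lam * (impulse lam t * Γ (k + 1 - t)) - lam * (impulse lam t * Γ (k - t)) := by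
      intro t ht
      rw [Finset.mem_range] at ht
      rw [show k + 1 - 1 - t + 1 = k + 1 - t by omega, show k + 1 - 1 - t = k - t by omega]
      ring
    rw [Finset.sum_congr rfl e, Finset.sum_sub_distrib, Finset.sum_range_succ',
      Finset.sum_range_succ _ k, Finset.sum_range_succ']
    simp only [diffImpulse, impulse, Nat.sub_self, h0, Nat.add_sub_add_right, Nat.sub_zero,
      mul_zero, add_zero]
    rw [add_sub_right_comm, ← Finset.sum_sub_distrib]
    congr 1
    · exact Finset.sum_congr rfl fun t _ => by ring
    · ring

/-! ### Weighted bounds for the responses -/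

/-- Cauchy–Schwarz with c² split as ρω. The factor ρ may depend on the eigenvalue, as only its total
mass survives; ω remains as the weight. -/
theorem sum_mul_sq_le_of_sq_le {k : ℕ} {c ρ ω z : ℕ → ℝ} {Θ : ℝ} (hρ : ∀ t, 0 ≤ ρ t)
    (hω : ∀ t, 0 ≤ ω t) (hc : ∀ t, c t ^ 2 ≤ ρ t * ω t)
    (hΘ : ∑ t ∈ Finset.range k, ρ t ≤ Θ) :
    (∑ t ∈ Finset.range k, c t * z t) ^ 2 ≤ ∑ t ∈ Finset.range k, Θ * ω t * z t ^ 2 := by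
  have h := Finset.sum_sq_le_sum_mul_sum_of_sq_le_mul (Finset.range k) (r := fun t => c t * z t)
    (f := ρ) (g := fun t => ω t * z t ^ 2) (fun t _ => hρ t)
    (fun t _ => mul_nonneg (hω t) (sq_nonneg _)) (fun t _ => by
      rw [mul_pow, ← mul_assoc]
      exact mul_le_mul_of_nonneg_right (hc t) (sq_nonneg _))
  refine h.trans ?_
  have h' : 0 ≤ ∑ t ∈ Finset.range k, ω t * z t ^ 2 :=
    Finset.sum_nonneg fun t _ => mul_nonneg (hω t) (sq_nonneg _)
  refine (mul_le_mul_of_nonneg_right hΘ h').trans (le_of_eq ?_)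
  rw [Finset.mul_sum]
  exact Finset.sum_congr rfl fun t _ => by ring

theorem sum_geometric_le {s : ℝ} (h0 : 0 ≤ s) (h1 : s < 1) (k : ℕ) :
    ∑ t ∈ Finset.range k, s ^ t ≤ 1 / (1 - s) := by
  have := geom_sum_Ico_le_of_lt_one (m := 0) (n := k) h0 h1
  simpa using this

theorem sum_range_le_of_succ {a : ℕ → ℝ} {x y : ℝ} (h0 : a 0 ≤ x) (hx : 0 ≤ x) (hy : 0 ≤ y)
    (h : ∀ k, ∑ t ∈ Finset.range k, a (t + 1) ≤ y) (k : ℕ) :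
    ∑ t ∈ Finset.range k, a t ≤ x + y := by
  cases k with
  | zero => simpa using add_nonneg hx hy
  | succ k =>
    rw [Finset.sum_range_succ']
    linarith [h k]

/-- The combination Θp ωp + Θn ωn dominates the Cauchy–Schwarz weight of either sign of λ, at the
price of total mass Θp² + Θn². One weight then serves all modes. -/
theorem exists_weight_of_sq_le {c : ℝ → ℕ → ℝ} {ωp ωn : ℕ → ℝ} {lam2 lamn Θp Θn M : ℝ}
    (hωp : ∀ t, 0 ≤ ωp t) (hωn : ∀ t, 0 ≤ ωn t) (hΘp : 0 ≤ Θp) (hΘn : 0 ≤ Θn)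
    (hp : ∀ k, ∑ t ∈ Finset.range k, ωp t ≤ Θp) (hn : ∀ k, ∑ t ∈ Finset.range k, ωn t ≤ Θn)
    (hM : Θp ^ 2 + Θn ^ 2 ≤ M)
    (hcp : ∀ lam, 0 ≤ lam → lam ≤ lam2 → ∃ ρ : ℕ → ℝ, (∀ t, 0 ≤ ρ t) ∧
      (∀ t, c lam t ^ 2 ≤ ρ t * ωp t) ∧ ∀ k, ∑ t ∈ Finset.range k, ρ t ≤ Θp)
    (hcn : ∀ lam, lamn ≤ lam → lam ≤ 0 → ∀ t, |c lam t| ≤ ωn t) :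
    ∃ ω : ℕ → ℝ, (∀ t, 0 ≤ ω t) ∧ (∀ k, ∑ t ∈ Finset.range k, ω t ≤ M) ∧
      ∀ lam, lamn ≤ lam → lam ≤ lam2 → ∀ (k : ℕ) (z : ℕ → ℝ),
        (∑ t ∈ Finset.range k, c lam t * z t) ^ 2
          ≤ ∑ t ∈ Finset.range k, ω t * z t ^ 2 := by
  refine ⟨fun t => Θp * ωp t + Θn * ωn t, fun t => ?_, fun k => ?_, fun lam h0 h1 k z => ?_⟩
  · have := hωp t
    have := hωn t
    positivity
  · rw [Finset.sum_add_distrib, ← Finset.mul_sum, ← Finset.mul_sum]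
    nlinarith [mul_le_mul_of_nonneg_left (hp k) hΘp, mul_le_mul_of_nonneg_left (hn k) hΘn]
  · rcases le_total 0 lam with h | h
    · obtain ⟨ρ, hρ, hc, hs⟩ := hcp lam h h1
      refine (sum_mul_sq_le_of_sq_le hρ hωp hc (hs k)).trans ?_
      refine Finset.sum_le_sum fun t _ => mul_le_mul_of_nonneg_right ?_ (sq_nonneg _)
      linarith [mul_nonneg hΘn (hωn t)]
    · refine (sum_mul_sq_le_of_sq_le hωn hωn (fun t => ?_) (hn k)).trans ?_
      · rw [← sq_abs, pow_two]
        have := hcn lam h0 h t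
        exact mul_self_le_mul_self (abs_nonneg _) this
      refine Finset.sum_le_sum fun t _ => mul_le_mul_of_nonneg_right ?_ (sq_nonneg _)
      linarith [mul_nonneg hΘp (hωp t)]

section Weights

variable {lam2 lamn : ℝ} (h2 : lam2 < 1) (hn : -(1 / 3) < lamn) (hle : lamn ≤ lam2)

include h2 hn hle

theorem exists_weight_diffImpulse :
    ∃ ω : ℕ → ℝ, (∀ t, 0 ≤ ω t) ∧
      (∀ k, ∑ t ∈ Finset.range k, ω t ≤ (3 * D₁ lam2 lamn) ^ 2) ∧
      ∀ lam, lamn ≤ lam → lam ≤ lam2 → ∀ (k : ℕ) (z : ℕ → ℝ),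
        (∑ t ∈ Finset.range k, diffImpulse lam t * z t) ^ 2
          ≤ ∑ t ∈ Finset.range k, ω t * z t ^ 2 := by
  have hD := D₁_nonneg h2 hn hle
  have hgp := gradient_sum_pos_le h2 hn hle
  have hgn := gradient_sum_neg_le h2 hn hle
  have hl0 : (0 : ℝ) ≤ max (-lamn) 0 := le_max_right _ _
  have hl1 : max (-lamn) 0 < 1 / 3 := max_lt (by linarith) (by norm_num)
  have hln : ∀ lam, lamn ≤ lam → -max (-lamn) 0 ≤ lam := fun lam h => by
    linarith [le_max_left (-lamn) 0]
  have hm0 : (0 : ℝ) ≤ max lam2 0 := le_max_right _ _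
  have hm1 : max lam2 0 < 1 := max_lt h2 one_pos
  have hml : ∀ lam, lam ≤ lam2 → lam ≤ max lam2 0 := fun lam h => h.trans (le_max_left _ _)
  generalize max (-lamn) 0 = l at *
  generalize max lam2 0 = m at *
  set s := Real.sqrt m with hs
  have hs0 : 0 ≤ s := Real.sqrt_nonneg _
  have hs2 : s ^ 2 = m := Real.sq_sqrt hm0
  have hs1 : s < 1 := by nlinarith
  let ωp : ℕ → ℝ := fun t => if t = 0 then 2 * m else s ^ t
  let ωn : ℕ → ℝ := fun t => if t = 0 then 2 * l else l * (negImpulse l t + negImpulse l (t - 1))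
  have hωp : ∀ t, 0 ≤ ωp t := fun t => by
    simp only [ωp]
    split_ifs <;> positivity
  have hωn : ∀ t, 0 ≤ ωn t := fun t => by
    have := negImpulse_nonneg hl0 t
    have := negImpulse_nonneg hl0 (t - 1)
    simp only [ωn]
    split_ifs <;> positivity
  have hsp : ∀ k, ∑ t ∈ Finset.range k, ωp t ≤ 7 / 4 * D₁ lam2 lamn := fun k => by
    refine (sum_range_le_of_succ (x := 2 * m) (y := s / (1 - s)) (by simp [ωp]) (by positivity)
      (div_nonneg hs0 (by linarith)) (fun k => ?_) k).trans hgp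
    have : ∀ t, ωp (t + 1) = s * s ^ t := fun t => by simp [ωp, pow_succ']
    simp only [this, ← Finset.mul_sum]
    rw [← mul_one_div]
    exact mul_le_mul_of_nonneg_left (sum_geometric_le hs0 hs1 k) hs0
  have hsn : ∀ k, ∑ t ∈ Finset.range k, ωn t ≤ 9 / 4 * D₁ lam2 lamn := fun k => by
    have hq := sum_negImpulse_le hl0 hl1
    refine le_trans ?_ hgn
    have e : 6 * l / (1 - 3 * l) = l * (3 / (1 - 3 * l)) + l * (3 / (1 - 3 * l)) := by ring
    rw [e]
    cases k with
    | zero =>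
      have : 0 ≤ 3 / (1 - 3 * l) := div_nonneg (by norm_num) (by linarith)
      simp only [Finset.sum_range_zero]
      positivity
    | succ k =>
      have e' : ∑ t ∈ Finset.range (k + 1), ωn t = l * ∑ t ∈ Finset.range (k + 1), negImpulse l t
          + l * ∑ t ∈ Finset.range k, negImpulse l t := by
        rw [Finset.sum_range_succ', Finset.sum_range_succ' _ k]
        simp only [ωn, negImpulse, Nat.add_sub_cancel, Nat.succ_ne_zero, if_false, if_true,
          mul_add, Finset.sum_add_distrib, Finset.mul_sum]
        ring
      rw [e']
      gcongr
      · exact hq _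
      · exact hq _
  refine exists_weight_of_sq_le hωp hωn (by positivity) (by positivity) hsp hsn ?_ ?_ ?_
  -- The numerical content is (7/4)² + (9/4)² ≤ 3².
  · nlinarith [sq_nonneg (D₁ lam2 lamn)]
  · intro lam h0 h1
    have hlm := hml lam h1
    refine ⟨ωp, hωp, fun t => ?_, hsp⟩
    rw [← pow_two]
    cases t with
    | zero =>
      simp only [diffImpulse, ωp, if_true]
      gcongr
    | succ t =>
      simp only [ωp, Nat.succ_ne_zero, if_false]
      refine (diffImpulse_sq_le h0 (by linarith) t).trans ?_
      rw [← pow_mul, mul_comm, pow_mul, hs2]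
      gcongr
  · intro lam h0 h1 t
    have hll := hln lam h0
    cases t with
    | zero =>
      simp only [diffImpulse, ωn, if_true, abs_mul, abs_two]
      have : |lam| ≤ l := abs_le.2 ⟨hll, by linarith⟩
      linarith
    | succ t =>
      simp only [diffImpulse, ωn, Nat.succ_ne_zero, if_false, abs_mul, Nat.add_sub_cancel]
      have : |lam| ≤ l := abs_le.2 ⟨hll, by linarith⟩
      have := abs_impulse_le hll h1 t
      have := abs_impulse_le hll h1 (t + 1)
      have := abs_sub (impulse lam (t + 1)) (impulse lam t)
      gcongr
      linarith

theorem exists_weight_impulse :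
    ∃ ω : ℕ → ℝ, (∀ t, 0 ≤ ω t) ∧
      (∀ k, ∑ t ∈ Finset.range k, ω t ≤ (5 / 2 * D₂ lam2 lamn) ^ 2) ∧
      ∀ lam, lamn ≤ lam → lam ≤ lam2 → ∀ (k : ℕ) (z : ℕ → ℝ),
        (∑ t ∈ Finset.range k, ((1 - lam) * impulse lam t) * z t) ^ 2
          ≤ ∑ t ∈ Finset.range k, ω t * z t ^ 2 := by
  have hD : 0 ≤ D₂ lam2 lamn := by linarith [two_le_D₂ h2 hn hle]
  have hgp := quantization_sum_pos_le h2 hn hle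
  have hgn := quantization_sum_neg_le h2 hn hle
  have hl0 : (0 : ℝ) ≤ max (-lamn) 0 := le_max_right _ _
  have hl1 : max (-lamn) 0 < 1 / 3 := max_lt (by linarith) (by norm_num)
  have hln : ∀ lam, lamn ≤ lam → -max (-lamn) 0 ≤ lam := fun lam h => by
    linarith [le_max_left (-lamn) 0]
  have hm0 : (0 : ℝ) ≤ max lam2 0 := le_max_right _ _
  have hm1 : max lam2 0 < 1 := max_lt h2 one_pos
  have hml : ∀ lam, lam ≤ lam2 → lam ≤ max lam2 0 := fun lam h => h.trans (le_max_left _ _)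
  generalize max (-lamn) 0 = l at *
  generalize max lam2 0 = m at *
  set s := Real.sqrt m with hs
  have hs0 : 0 ≤ s := Real.sqrt_nonneg _
  have hs2 : s ^ 2 = m := Real.sq_sqrt hm0
  have hs1 : s < 1 := by nlinarith
  set c := Real.sqrt (1 - m) with hc
  have hc0 : 0 < c := Real.sqrt_pos.2 (by linarith)
  have hc2 : c ^ 2 = 1 - m := Real.sq_sqrt (by linarith)
  have hcs : c ^ 2 = (1 - s) * (1 + s) := by rw [hc2, ← hs2]; ring
  let ωp : ℕ → ℝ := fun t => if t = 0 then 2 else c * s ^ (t - 1)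
  let ωn : ℕ → ℝ := fun t => (1 + l) * negImpulse l t
  have hωp : ∀ t, 0 ≤ ωp t := fun t => by
    simp only [ωp]
    split_ifs <;> positivity
  have hωn : ∀ t, 0 ≤ ωn t := fun t =>
    mul_nonneg (by linarith) (negImpulse_nonneg hl0 t)
  refine exists_weight_of_sq_le hωp hωn (Θp := 2 * D₂ lam2 lamn) (Θn := 3 / 2 * D₂ lam2 lamn)
    (by positivity) (by positivity) ?_ ?_ ?_ ?_ ?_
  · intro k
    refine (sum_range_le_of_succ (x := 2) (y := 2 / c) (by simp [ωp]) (by norm_num)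
      (by positivity) (fun k => ?_) k).trans hgp
    simp only [ωp, Nat.succ_ne_zero, if_false, Nat.add_sub_cancel, ← Finset.mul_sum]
    refine (mul_le_mul_of_nonneg_left (sum_geometric_le hs0 hs1 k) hc0.le).trans ?_
    rw [mul_one_div, div_le_div_iff₀ (by linarith) hc0]
    nlinarith
  · intro k
    simp only [ωn, ← Finset.mul_sum]
    exact (mul_le_mul_of_nonneg_left (sum_negImpulse_le hl0 hl1 k) (by linarith)).trans hgn
  -- Here 2² + (3/2)² = (5/2)² exactly.
  · nlinarith [sq_nonneg (D₂ lam2 lamn)]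
  · intro lam h0 h1
    have hlm := hml lam h1
    -- The bound (1 - λ)λᵗ for the squared response is split as ((1 - λ)/c · qᵗ)(c · sᵗ) with qs =
    -- λ. The second factor is free of λ, and each factor sums to at most 2/c. If s = 0, then λ = 0
    -- and the division gives q = 0, as needed.
    set q := lam / s with hq
    have hq0 : 0 ≤ q := div_nonneg h0 hs0
    have hqs : q * s = lam := by
      rcases hs0.eq_or_lt with h | h
      · rw [← h, mul_zero]
        have : m = 0 := by rw [← hs2, ← h]; norm_num
        linarith
      · exact div_mul_cancel₀ _ h.ne'
    have hqs' : q ≤ s := by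
      rw [hq]
      rcases hs0.eq_or_lt with h | h
      · rw [← h, div_zero]
      · rw [div_le_iff₀ h]
        nlinarith
    let ρ : ℕ → ℝ := fun t => if t = 0 then 2 else (1 - lam) / c * q ^ (t - 1)
    have h1l : 0 ≤ 1 - lam := by linarith
    refine ⟨ρ, fun t => ?_, fun t => ?_, fun k => ?_⟩
    · simp only [ρ]
      split_ifs <;> positivity
    · cases t with
      | zero =>
        simp only [impulse, ρ, ωp, if_true]
        nlinarith
      | succ t =>
        simp only [ρ, ωp, Nat.succ_ne_zero, if_false, Nat.add_sub_cancel]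
        have e : (1 - lam) / c * q ^ t * (c * s ^ t) = (1 - lam) * lam ^ t := by
          rw [← hqs, mul_pow]
          field_simp
        rw [e, mul_pow, pow_two (1 - lam), mul_assoc]
        exact mul_le_mul_of_nonneg_left (one_sub_mul_impulse_sq_le h0 t) h1l
    · refine (sum_range_le_of_succ (x := 2) (y := 2 / c) (by simp [ρ]) (by norm_num)
        (by positivity) (fun k => ?_) k).trans hgp
      simp only [ρ, Nat.succ_ne_zero, if_false, Nat.add_sub_cancel, ← Finset.mul_sum]
      refine (mul_le_mul_of_nonneg_left (sum_geometric_le hq0 (hqs'.trans_lt hs1) k)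
        (by positivity)).trans ?_
      rw [mul_one_div, div_div, div_le_div_iff₀ (mul_pos hc0 (by linarith)) hc0]
      -- From q ≤ s one gets qs ≥ q² ≥ 2q - 1.
      have : 1 - lam ≤ 2 * (1 - q) := by
        rw [← hqs]
        nlinarith [sq_nonneg (1 - s)]
      nlinarith
  · intro lam h0 h1 t
    rw [abs_mul]
    have : |1 - lam| ≤ 1 + l := by
      rw [abs_of_nonneg (by linarith)]
      linarith [hln lam h0]
    exact mul_le_mul this (abs_impulse_le (hln lam h0) h1 t) (abs_nonneg _) (by linarith)

end Weights

/-! ### The eigenbasis of the communication matrix -/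

theorem sortedEigenvalue_antitone {n : ℕ} {W : Matrix (Fin n) (Fin n) ℝ} (hW : W.IsSymm) :
    Antitone (sortedEigenvalue hW) := fun i j hij =>
  (isHermitian_of_isSymm hW).eigenvalues₀_antitone <| by
    rw [Fin.le_def] at hij ⊢
    exact hij

/-- Here m₀ is the index of the largest eigenvalue. Since `lam2` < 1, every other eigenvector is
orthogonal to the all-ones vector, so m₀ carries the consensus direction; its own eigenvalue is
never needed. -/
theorem exists_eigenbasis {n : ℕ} (hn : 2 ≤ n) {W : Matrix (Fin n) (Fin n) ℝ} (hW : W.IsSymm)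
    (hds : W ∈ doublyStochastic ℝ (Fin n)) (h2 : sortedEigenvalue hW ⟨1, by omega⟩ < 1) :
    ∃ (φ : Fin n → Fin n → ℝ) (ev : Fin n → ℝ) (m₀ : Fin n),
      (∀ m j, ∑ i, W j i * φ m i = ev m * φ m j) ∧
      (∀ z : Fin n → ℝ, ∑ m, (∑ i, φ m i * z i) ^ 2 = ∑ i, z i ^ 2) ∧
      (∀ m, m ≠ m₀ → sortedEigenvalue hW ⟨n - 1, by omega⟩ ≤ ev m) ∧
      (∀ m, m ≠ m₀ → ev m ≤ sortedEigenvalue hW ⟨1, by omega⟩) ∧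
      (∀ m, m ≠ m₀ → ∑ i, φ m i = 0) ∧
      ∀ z : Fin n → ℝ, ∑ i, z i = 0 → ∑ i, φ m₀ i * z i = 0 := by
  set hH := isHermitian_of_isSymm hW
  set b := hH.eigenvectorBasis with hb
  set eq : Fin (Fintype.card (Fin n)) ≃ Fin n :=
    Fintype.equivOfCardEq (Fintype.card_fin _) with heq
  set m₀ : Fin n := eq (Fin.cast (Fintype.card_fin n).symm ⟨0, by omega⟩) with hm₀
  have hev : ∀ m, hH.eigenvalues m
      = sortedEigenvalue hW (Fin.cast (Fintype.card_fin n) (eq.symm m)) := fun m => rfl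
  have hinner : ∀ m (z : EuclideanSpace ℝ (Fin n)), inner ℝ (b m) z = ∑ i, b m i * z i := by
    intro m z
    rw [PiLp.inner_apply]
    exact Finset.sum_congr rfl fun i _ => by simp [mul_comm]
  have heig : ∀ m j, ∑ i, W j i * b m i = hH.eigenvalues m * b m j := fun m j => by
    have := congrFun (hH.mulVec_eigenvectorBasis m) j
    simpa [Matrix.mulVec, dotProduct] using this
  have hle2 : ∀ m, m ≠ m₀ → hH.eigenvalues m ≤ sortedEigenvalue hW ⟨1, by omega⟩ := by
    intro m hm
    rw [hev]
    refine sortedEigenvalue_antitone hW ?_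
    rw [Fin.le_def]
    change 1 ≤ (eq.symm m : ℕ)
    by_contra hlt
    refine hm ?_
    rw [hm₀, ← Equiv.symm_apply_eq]
    ext
    simp only [Fin.val_cast]
    omega
  have hzero : ∀ m, m ≠ m₀ → ∑ i, b m i = 0 := by
    intro m hm
    have h1 : ∑ j, ∑ i, W j i * b m i = ∑ i, b m i := by
      rw [Finset.sum_comm]
      refine Finset.sum_congr rfl fun i _ => ?_
      rw [← Finset.sum_mul, sum_col_of_mem_doublyStochastic hds i, one_mul]
    simp only [heig, ← Finset.mul_sum] at h1
    have h3 := hle2 m hm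
    have h4 : (hH.eigenvalues m - 1) * ∑ i, b m i = 0 := by linear_combination h1
    rcases mul_eq_zero.1 h4 with h | h
    · linarith
    · exact h
  -- Expanding the inner product of the all-ones vector with z in the basis leaves only the m₀ term.
  -- With z constant 1 it shows that the m₀ eigenvector has nonzero sum.
  have hone : ∀ z : EuclideanSpace ℝ (Fin n),
      (∑ i, b m₀ i) * ∑ i, b m₀ i * z i = ∑ i, z i := by
    intro z
    have h := b.sum_inner_mul_inner (WithLp.toLp 2 fun _ => (1 : ℝ)) z
    have e : ∀ m, inner ℝ (WithLp.toLp 2 fun _ => (1 : ℝ)) (b m) = ∑ i, b m i := fun m => by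
      rw [real_inner_comm, hinner]
      simp
    rw [Finset.sum_eq_single m₀ (fun m _ hm => by rw [e, hzero m hm, zero_mul])
      (fun h => absurd (Finset.mem_univ _) h), e, hinner] at h
    rw [h, PiLp.inner_apply]
    exact Finset.sum_congr rfl fun i _ => by simp
  refine ⟨fun m i => b m i, hH.eigenvalues, m₀, heig, fun z => ?_, fun m _ => ?_, hle2, hzero,
    fun z hz => ?_⟩
  · have := b.sum_sq_norm_inner_right (WithLp.toLp 2 z)
    rw [EuclideanSpace.norm_sq_eq] at this
    simpa only [hinner, Real.norm_eq_abs, sq_abs] using this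
  · rw [hev]
    refine sortedEigenvalue_antitone hW ?_
    rw [Fin.le_def]
    have := (Fin.cast (Fintype.card_fin n) (eq.symm m)).isLt
    change _ ≤ n - 1
    omega
  · have h1 := hone (WithLp.toLp 2 fun _ => (1 : ℝ))
    have h2 := hone (WithLp.toLp 2 z)
    simp only [hz, mul_one, Finset.sum_const, Finset.card_univ, Fintype.card_fin,
      nsmul_eq_mul] at h1 h2
    rcases mul_eq_zero.1 h2 with h | h
    · rw [h, zero_mul] at h1
      have : (n : ℝ) ≠ 0 := by positivity
      exact absurd h1.symm this
    · exact h

/-! ### Dispersion around the average -/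

/-- The sum of the squared deviations of `z` from its average. -/
noncomputable def dispersion {n : ℕ} (z : Fin n → ℝ) : ℝ :=
  ∑ i, (z i - (n : ℝ)⁻¹ * ∑ j, z j) ^ 2

theorem sq_sub_le_two_mul_dispersion {n : ℕ} (z : Fin n → ℝ) (i j : Fin n) :
    (z i - z j) ^ 2 ≤ 2 * dispersion z := by
  set m := (n : ℝ)⁻¹ * ∑ j, z j with hm
  have h0 : 0 ≤ dispersion z := Finset.sum_nonneg fun _ _ => sq_nonneg _
  rcases eq_or_ne i j with rfl | hij
  · simpa using h0
  have h : (z i - m) ^ 2 + (z j - m) ^ 2 ≤ dispersion z := by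
    rw [← Finset.sum_pair (f := fun i => (z i - m) ^ 2) hij]
    exact Finset.sum_le_sum_of_subset_of_nonneg (Finset.subset_univ _) fun _ _ _ => sq_nonneg _
  nlinarith [sq_nonneg (z i - m + (z j - m))]

theorem dispersion_le_of_two_mul_eq {n : ℕ} {x y z : Fin n → ℝ} {M : ℝ}
    (h : ∀ i, 2 * z i = x i + y i) (hx : dispersion x ≤ M) (hy : dispersion y ≤ M) :
    dispersion z ≤ M := by
  obtain rfl : z = fun i => (x i + y i) / 2 := funext fun i => by linarith [h i]
  have : dispersion (fun i => (x i + y i) / 2) ≤ (dispersion x + dispersion y) / 2 := by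
    rw [dispersion, dispersion, dispersion, ← Finset.sum_add_distrib, Finset.sum_div]
    refine Finset.sum_le_sum fun i _ => ?_
    rw [← Finset.sum_div, Finset.sum_add_distrib]
    nlinarith [sq_nonneg ((x i - (n : ℝ)⁻¹ * ∑ j, x j) - (y i - (n : ℝ)⁻¹ * ∑ j, y j))]
  linarith

theorem sum_add_sq_le {ι : Type*} (s : Finset ι) {u v : ι → ℝ} {a b : ℝ} (ha : 0 ≤ a)
    (hb : 0 ≤ b) (hu : ∑ i ∈ s, u i ^ 2 ≤ a ^ 2) (hv : ∑ i ∈ s, v i ^ 2 ≤ b ^ 2) :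
    ∑ i ∈ s, (u i + v i) ^ 2 ≤ (a + b) ^ 2 := by
  have hc := Finset.sum_mul_sq_le_sq_mul_sq s u v
  have h0 : 0 ≤ ∑ i ∈ s, v i ^ 2 := Finset.sum_nonneg fun _ _ => sq_nonneg _
  have h1 : (∑ i ∈ s, u i * v i) ^ 2 ≤ (a * b) ^ 2 := by
    rw [mul_pow]
    exact hc.trans (mul_le_mul hu hv h0 (sq_nonneg a))
  have h2 := (abs_le_of_sq_le_sq' h1 (mul_nonneg ha hb)).2
  have e : ∑ i ∈ s, (u i + v i) ^ 2
      = ∑ i ∈ s, u i ^ 2 + 2 * ∑ i ∈ s, u i * v i + ∑ i ∈ s, v i ^ 2 := by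
    rw [Finset.mul_sum, ← Finset.sum_add_distrib, ← Finset.sum_add_distrib]
    exact Finset.sum_congr rfl fun i _ => by ring
  rw [e]
  nlinarith

/-- Because ω does not depend on the mode m, the sums can be exchanged and Parseval turns each time
slice into a sum over workers. -/
theorem sum_weighted_sq_le {ι : Type*} {n k : ℕ} (s : Finset (Fin n)) {φ : Fin n → ι → ℝ}
    [Fintype ι] (hφ : ∀ z : ι → ℝ, ∑ m, (∑ i, φ m i * z i) ^ 2 = ∑ i, z i ^ 2)
    {ω : ℕ → ℝ} (hω : ∀ t, 0 ≤ ω t) {M b : ℝ} (hM : ∑ t ∈ Finset.range k, ω t ≤ M)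
    {z : ℕ → ι → ℝ} (hz : ∀ t < k, ∀ i, |z t i| ≤ b) :
    ∑ m ∈ s, ∑ t ∈ Finset.range k, ω t * (∑ i, φ m i * z t i) ^ 2
      ≤ M * (Fintype.card ι * b ^ 2) := by
  have h1 : ∑ m ∈ s, ∑ t ∈ Finset.range k, ω t * (∑ i, φ m i * z t i) ^ 2
      ≤ ∑ m, ∑ t ∈ Finset.range k, ω t * (∑ i, φ m i * z t i) ^ 2 :=
    Finset.sum_le_sum_of_subset_of_nonneg (Finset.subset_univ _) fun m _ _ =>
      Finset.sum_nonneg fun t _ => mul_nonneg (hω t) (sq_nonneg _)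
  refine h1.trans ?_
  rw [Finset.sum_comm]
  have h2 : ∀ t ∈ Finset.range k, ∑ m, ω t * (∑ i, φ m i * z t i) ^ 2
      ≤ ω t * (Fintype.card ι * b ^ 2) := by
    intro t ht
    rw [← Finset.mul_sum, hφ]
    refine mul_le_mul_of_nonneg_left ?_ (hω t)
    have h3 : ∀ i ∈ Finset.univ, z t i ^ 2 ≤ b ^ 2 := fun i _ => by
      rw [← sq_abs]
      have := hz t (Finset.mem_range.1 ht) i
      gcongr
    simpa [nsmul_eq_mul] using Finset.sum_le_card_nsmul _ _ _ h3
  refine (Finset.sum_le_sum h2).trans ?_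
  rw [← Finset.sum_mul]
  exact mul_le_mul_of_nonneg_right hM (by positivity)

/-! ### Consensus in the perturbed linear system -/

section LinearSystem

variable {n : ℕ} {W : Matrix (Fin n) (Fin n) ℝ} {lam2 lamn : ℝ}

theorem dispersion_extrapolation_le (hn2 : 2 ≤ n) (hW : W.IsSymm)
    (hds : W ∈ doublyStochastic ℝ (Fin n)) (hl2 : sortedEigenvalue hW ⟨1, by omega⟩ = lam2)
    (hln : sortedEigenvalue hW ⟨n - 1, by omega⟩ = lamn) (h2 : lam2 < 1) (hn : -(1 / 3) < lamn)
    {α G ε : ℝ} (hα : 0 ≤ α) (hG : 0 ≤ G) (hε : 0 ≤ ε) {K : ℕ} {X Γ e : ℕ → Fin n → ℝ}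
    (hX0 : X 0 = 0) (hX1 : X 1 = 0) (hΓ0 : Γ 0 = 0)
    (hX : ∀ k < K, ∀ i, X (k + 2) i
      = ∑ j, W j i * (2 * X (k + 1) j - X k j - α * (Γ (k + 1) j - Γ k j) + e k j) - e k i)
    (hΓ : ∀ k ≤ K, ∀ i, |Γ k i| ≤ G) (he : ∀ k < K, ∀ i, |e k i| ≤ ε) {k : ℕ} (hk : k ≤ K) :
    dispersion (fun i => 2 * X (k + 1) i - X k i)
      ≤ n * (3 * D₁ lam2 lamn * (α * G) + 5 / 2 * D₂ lam2 lamn * ε) ^ 2 := by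
  have hle : lamn ≤ lam2 := by
    rw [← hl2, ← hln]
    exact sortedEigenvalue_antitone hW (by rw [Fin.le_def]; change 1 ≤ n - 1; omega)
  obtain ⟨φ, ev, m₀, heig, hpar, hge, hle2, hzero, hm₀⟩ :=
    exists_eigenbasis hn2 hW hds (by rw [hl2]; exact h2)
  rw [hln] at hge
  rw [hl2] at hle2
  obtain ⟨ω, hω0, hωs, hω⟩ := exists_weight_diffImpulse h2 hn hle
  obtain ⟨ω', hω0', hωs', hω'⟩ := exists_weight_impulse h2 hn hle
  have hD1 := D₁_nonneg h2 hn hle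
  have hD2 : 0 ≤ D₂ lam2 lamn := by linarith [two_le_D₂ h2 hn hle]
  set r : Fin n → ℝ := fun i => 2 * X (k + 1) i - X k i with hr
  set A : Fin n → ℝ := fun m =>
    -α * ∑ t ∈ Finset.range k, diffImpulse (ev m) t * ∑ i, φ m i * Γ (k - t) i with hA
  set B : Fin n → ℝ := fun m => -∑ t ∈ Finset.range k,
    ((1 - ev m) * impulse (ev m) t) * ∑ i, φ m i * e (k - 1 - t) i with hB
  have hrm : ∀ m, ∑ i, φ m i * r i = A m + B m := by
    intro m
    set Y : ℕ → ℝ := fun k => ∑ i, φ m i * X k i with hY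
    set γ : ℕ → ℝ := fun k => ∑ i, φ m i * Γ k i with hγ
    set η : ℕ → ℝ := fun k => ∑ i, φ m i * e k i with hη
    -- The error enters before mixing with factor λ and leaves afterwards with factor 1, hence the
    -- coefficient -(1 - λ), which is the factor bounded together with the response in
    -- `exists_weight_impulse`.
    have hrec : ∀ k < K, Y (k + 2) = ev m * (2 * Y (k + 1) - Y k)
        + (-α * (ev m * (γ (k + 1) - γ k)) - (1 - ev m) * η k) := by
      intro k hk
      have e1 : ∀ v : Fin n → ℝ, ∑ i, φ m i * ∑ j, W j i * v j = ev m * ∑ j, φ m j * v j := by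
        intro v
        simp only [Finset.mul_sum]
        rw [Finset.sum_comm]
        refine Finset.sum_congr rfl fun j _ => ?_
        rw [← mul_assoc, ← heig m j, Finset.sum_mul]
        exact Finset.sum_congr rfl fun i _ => by ring
      have e2 : Y (k + 2) = ∑ i, φ m i * ∑ j, W j i
          * (2 * X (k + 1) j - X k j - α * (Γ (k + 1) j - Γ k j) + e k j) - η k := by
        rw [hY, hη, ← Finset.sum_sub_distrib]
        exact Finset.sum_congr rfl fun i _ => by rw [hX k hk i]; ring
      have e3 : ∑ j, φ m j * (2 * X (k + 1) j - X k j - α * (Γ (k + 1) j - Γ k j) + e k j)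
          = 2 * Y (k + 1) - Y k - α * (γ (k + 1) - γ k) + η k := by
        simp only [hY, hη, hγ, Finset.mul_sum, ← Finset.sum_sub_distrib,
          ← Finset.sum_add_distrib]
        exact Finset.sum_congr rfl fun i _ => by ring
      rw [e2, e1, e3]
      ring
    have hconv := convolution_impulse (ev m)
      (fun k => -α * (ev m * (γ (k + 1) - γ k)) - (1 - ev m) * η k) Y (by simp [hY, hX0])
      (by simp [hY, hX1]) K hrec k hk
    have e4 : ∑ i, φ m i * r i = 2 * Y (k + 1) - Y k := by
      simp only [hY, hr, Finset.mul_sum, ← Finset.sum_sub_distrib]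
      exact Finset.sum_congr rfl fun i _ => by ring
    rw [e4, hconv]
    simp only [hA, hB]
    rw [← sum_impulse_mul_sub (ev m) γ (by simp [hγ, hΓ0]) k, Finset.mul_sum,
      ← sub_eq_add_neg, ← Finset.sum_sub_distrib]
    exact Finset.sum_congr rfl fun t _ => by ring
  set a := (n : ℝ)⁻¹ * ∑ j, r j with ha
  have hn0 : (n : ℝ) ≠ 0 := by positivity
  -- Subtracting the average removes the m₀ component and does not change the others, whose
  -- eigenvectors have zero sum.
  have hdisp : dispersion r = ∑ m ∈ Finset.univ.erase m₀, (A m + B m) ^ 2 := by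
    rw [dispersion, ← hpar (fun i => r i - a), ← Finset.add_sum_erase _ _ (Finset.mem_univ m₀),
      hm₀ (fun i => r i - a), zero_pow two_ne_zero, zero_add]
    · refine Finset.sum_congr rfl fun m hm => ?_
      rw [← hrm m]
      congr 1
      simp only [mul_sub, Finset.sum_sub_distrib, ← Finset.sum_mul,
        hzero m (Finset.ne_of_mem_erase hm), zero_mul, sub_zero]
    · simp only [Finset.sum_sub_distrib, Finset.sum_const, Finset.card_univ, Fintype.card_fin,
        nsmul_eq_mul, ha]
      field_simp
      ring
  have hsn : Real.sqrt n ^ 2 = n := Real.sq_sqrt (Nat.cast_nonneg n)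
  have hAs : ∑ m ∈ Finset.univ.erase m₀, A m ^ 2
      ≤ (Real.sqrt n * (3 * D₁ lam2 lamn * (α * G))) ^ 2 := by
    have h3 : ∀ m ∈ Finset.univ.erase m₀, A m ^ 2 ≤ α ^ 2 *
        ∑ t ∈ Finset.range k, ω t * (∑ i, φ m i * Γ (k - t) i) ^ 2 := by
      intro m hm
      have hm' := Finset.ne_of_mem_erase hm
      simp only [hA, mul_pow, neg_sq]
      exact mul_le_mul_of_nonneg_left (hω (ev m) (hge m hm') (hle2 m hm') k _) (sq_nonneg _)
    refine (Finset.sum_le_sum h3).trans ?_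
    rw [← Finset.mul_sum]
    refine (mul_le_mul_of_nonneg_left (sum_weighted_sq_le (Finset.univ.erase m₀) hpar hω0 (hωs k)
      (z := fun t => Γ (k - t)) (b := G) fun t _ i => hΓ _ (by omega) i)
      (sq_nonneg α)).trans (le_of_eq ?_)
    rw [Fintype.card_fin, mul_pow (Real.sqrt n), hsn]
    ring
  have hBs : ∑ m ∈ Finset.univ.erase m₀, B m ^ 2
      ≤ (Real.sqrt n * (5 / 2 * D₂ lam2 lamn * ε)) ^ 2 := by
    have h3 : ∀ m ∈ Finset.univ.erase m₀, B m ^ 2 ≤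
        ∑ t ∈ Finset.range k, ω' t * (∑ i, φ m i * e (k - 1 - t) i) ^ 2 := by
      intro m hm
      have hm' := Finset.ne_of_mem_erase hm
      simp only [hB, neg_sq]
      exact hω' (ev m) (hge m hm') (hle2 m hm') k _
    refine (Finset.sum_le_sum h3).trans ?_
    refine (sum_weighted_sq_le (Finset.univ.erase m₀) hpar hω0' (hωs' k)
      (z := fun t => e (k - 1 - t)) (b := ε) fun t ht i => he _ (by omega) i).trans (le_of_eq ?_)
    rw [Fintype.card_fin, mul_pow (Real.sqrt n), hsn]
    ring
  rw [hdisp]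
  refine (sum_add_sq_le _ (by positivity) (by positivity) hAs hBs).trans (le_of_eq ?_)
  rw [← mul_add, mul_pow, hsn]

/-- X(k+1) is the midpoint of the extrapolation 2X(k+1) - X(k) and X(k), so convexity propagates the
bound with no loss. -/
theorem dispersion_le_of_extrapolation {M : ℝ} (hM : 0 ≤ M) {K : ℕ} {X : ℕ → Fin n → ℝ}
    (hX0 : X 0 = 0) (h : ∀ k ≤ K, dispersion (fun i => 2 * X (k + 1) i - X k i) ≤ M) :
    ∀ k ≤ K + 1, dispersion (X k) ≤ M
  | 0, _ => by simpa [hX0, dispersion] using hM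
  | k + 1, hk => by
    have i0 := dispersion_le_of_extrapolation hM hX0 h k (by omega)
    exact dispersion_le_of_two_mul_eq (fun i => by ring) (h k (by omega)) i0

end LinearSystem

/-! ### Modulo-quantized communication -/

theorem cmod_sub_mul_int {a : ℝ} (ha : 0 < a) (z : ℝ) (k : ℤ) :
    cmod (z - a * k) a = cmod z a := by
  have e : (z - a * k) / a + 1 / 2 = z / a + 1 / 2 - k := by
    field_simp
    ring
  rw [cmod, cmod, e, Int.floor_sub_intCast]
  push_cast
  ring

theorem cmod_eq_self {a z : ℝ} (ha : 0 < a) (hz : |z| < a / 2) : cmod z a = z := by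
  obtain ⟨h1, h2⟩ := abs_lt.1 hz
  have : ⌊z / a + 1 / 2⌋ = 0 := by
    rw [Int.floor_eq_zero_iff, Set.mem_Ico]
    have e1 : -(1 / 2) ≤ z / a := by
      rw [le_div_iff₀ ha]
      linarith
    have e2 : z / a < 1 / 2 := by
      rw [div_lt_iff₀ ha]
      linarith
    constructor <;> linarith
  rw [cmod, this]
  simp

theorem cmod_one_mem_Ico (z : ℝ) : cmod z 1 ∈ Set.Ico (-(1 / 2) : ℝ) (1 / 2) := by
  have h1 := Int.floor_le (z + 1 / 2)
  have h2 := Int.lt_floor_add_one (z + 1 / 2)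
  rw [cmod, div_one, one_mul, Set.mem_Ico]
  constructor <;> linarith

section Communication

variable {d : ℕ} {B δ : ℝ} {Q : Model d → Model d}

theorem selfTerm_apply (B : ℝ) (q h : Model d) (c : Fin d) :
    selfTerm B q h c = B * q c - cmod (h c) B + h c := rfl

theorem recovered_apply (B : ℝ) (q h : Model d) (c : Fin d) :
    recovered B q h c = cmod (B * q c - h c) B + h c := rfl

theorem abs_selfTerm_sub_le (hB : 0 < B) (hQ : IsQuantizer δ Q) (h : Model d) (c : Fin d) :
    |selfTerm B (message Q B h) h c - h c| ≤ B * δ := by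
  have hq := hQ (vmod (B⁻¹ • h) 1) (fun c => cmod_one_mem_Ico _) c
  have e : cmod (h c) B = B * vmod (B⁻¹ • h) 1 c := by
    change _ = B * cmod (B⁻¹ * h c) 1
    rw [cmod, cmod, div_one, inv_mul_eq_div]
    field_simp
  rw [selfTerm_apply, e, add_sub_cancel_right, message, ← mul_sub, abs_mul, abs_of_pos hB]
  exact mul_le_mul_of_nonneg_left hq hB.le

/-- The decoded argument differs by an integer multiple of B from S - h, where S is the sender's
biased term. As |S - h| ≤ |S - h'| + |h' - h| < Bδ + θ = B/2, the centred modulo returns S - h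
itself. -/
theorem recovered_eq_selfTerm (hB : 0 < B) (hQ : IsQuantizer δ Q) {θ : ℝ}
    (hθ : θ + B * δ = B / 2) {h h' : Model d} {c : Fin d} (hh : |h' c - h c| < θ) :
    recovered B (message Q B h') h c = selfTerm B (message Q B h') h' c := by
  have hs := abs_selfTerm_sub_le hB hQ h' c
  rw [selfTerm_apply] at hs
  rw [recovered_apply, selfTerm_apply]
  set q := message Q B h' c
  set S := B * q - cmod (h' c) B + h' c with hS
  have e : B * q - h c = (S - h c) - B * (⌊h' c / B + 1 / 2⌋ : ℤ) := by
    rw [hS, cmod]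
    ring
  rw [e, cmod_sub_mul_int hB, cmod_eq_self hB, sub_add_cancel]
  have := abs_add_le (S - h' c) (h' c - h c)
  rw [sub_add_sub_cancel] at this
  linarith

theorem communicate_apply {n : ℕ} {W : Matrix (Fin n) (Fin n) ℝ}
    (hds : W ∈ doublyStochastic ℝ (Fin n)) (hB : 0 < B) {θ : ℝ} (hθ : θ + B * δ = B / 2)
    {q : Fin n → Model d → Model d} (hq : ∀ i, IsQuantizer δ (q i)) {h : Fin n → Model d}
    {c : Fin d} (hh : ∀ i j, |h i c - h j c| < θ) (i : Fin n) :
    communicate W B q h i c = ∑ j, W j i * (h j c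
        + (selfTerm B (message (q j) B (h j)) (h j) c - h j c))
      - (selfTerm B (message (q i) B (h i)) (h i) c - h i c) := by
  set S : Fin n → ℝ := fun j => selfTerm B (message (q j) B (h j)) (h j) c with hS
  have e1 : communicate W B q h i c = h i c + ∑ j ∈ neighbors W i, W j i * (S j - S i) := by
    have : ∀ j ∈ neighbors W i, W j i * (S j - S i)
        = (W j i • (recovered B (message (q j) B (h j)) (h i)
          - selfTerm B (message (q i) B (h i)) (h i))) c := by
      intro j _
      rw [PiLp.smul_apply, PiLp.sub_apply, recovered_eq_selfTerm hB (hq j) hθ (hh j i),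
        smul_eq_mul]
    rw [Finset.sum_congr rfl this, communicate, PiLp.add_apply, WithLp.ofLp_sum, Finset.sum_apply]
  have e2 : ∑ j ∈ neighbors W i, W j i * (S j - S i) = ∑ j, W j i * (S j - S i) := by
    refine Finset.sum_subset (Finset.subset_univ _) fun j _ hj => ?_
    by_cases hji : j = i
    · rw [hji, sub_self, mul_zero]
    · have : W j i = 0 := by
        by_contra hne
        exact hj (by simp [neighbors, hji, hne])
      rw [this, zero_mul]
  have e3 : ∑ j, W j i * (S j - S i) = ∑ j, W j i * S j - S i := by
    simp only [mul_sub, Finset.sum_sub_distrib, ← Finset.sum_mul,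
      sum_col_of_mem_doublyStochastic hds i, one_mul]
  rw [e1, e2, e3]
  simp only [add_sub_cancel]
  ring

end Communication

/-! ### Trajectories -/

section Trajectory

variable {n d : ℕ}

/-- The models before the communication in iteration `k`, for the models `x` and the sampled
gradients `γ`. -/
noncomputable def intermediate (α : ℝ) (x γ : ℕ → Fin n → Model d) : ℕ → Fin n → Model d
  | 0 => fun i => x 0 i - α • γ 0 i
  | k + 1 => fun i => (2 : ℝ) • x (k + 1) i - x k i - α • γ (k + 1) i + α • γ k i

theorem iterates_succ {Ξ U : Type*} (W : Matrix (Fin n) (Fin n) ℝ) (B α : ℝ)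
    (g : Fin n → Model d → Ξ → Model d) (Q : U → Model d → Model d)
    (s : ℕ → Fin n → Ξ) (u : ℕ → Fin n → U) (k : ℕ) :
    iterates W B α g Q s u (k + 1) = communicate W B (fun i => Q (u k i))
      (intermediate α (iterates W B α g Q s u)
        (fun k i => g i (iterates W B α g Q s u k i) (s k i)) k) := by
  cases k <;> rfl

/-- A sequence shifted by one, starting with `0`. -/
def shifted {E : Type*} [Zero E] (x : ℕ → E) : ℕ → E
  | 0 => 0
  | k + 1 => x k

/-- Prepending a zero model and a zero gradient makes the first iteration an instance of the general
second-order recurrence. -/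
theorem intermediate_apply {α : ℝ} {x γ : ℕ → Fin n → Model d} (hx : x 0 = 0) (k : ℕ)
    (i : Fin n) (c : Fin d) :
    intermediate α x γ k i c = 2 * shifted x (k + 1) i c - shifted x k i c
      - α * (shifted γ (k + 1) i c - shifted γ k i c) := by
  cases k with
  | zero => simp [intermediate, shifted, hx]
  | succ k =>
    simp only [intermediate, shifted, PiLp.add_apply, PiLp.sub_apply, PiLp.smul_apply, smul_eq_mul]
    ring

theorem average_apply (x : Fin n → Model d) (c : Fin d) :
    average x c = (n : ℝ)⁻¹ * ∑ i, x i c := by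
  rw [average, PiLp.smul_apply, WithLp.ofLp_sum, Finset.sum_apply, smul_eq_mul]

theorem sum_norm_sub_average_sq (x : Fin n → Model d) :
    ∑ i, ‖x i - average x‖ ^ 2 = ∑ c, dispersion fun i => x i c := by
  simp only [dispersion, EuclideanSpace.norm_sq_eq, Real.norm_eq_abs, sq_abs, PiLp.sub_apply,
    average_apply]
  exact Finset.sum_comm

/-- The parameters of the algorithm for given eigenvalues and step size. -/
structure IsTuned (n : ℕ) (lam2 lamn α G δ θ : ℝ) : Prop where
  two_le : 2 ≤ n
  lam2_lt : lam2 < 1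
  lt_lamn : -(1 / 3) < lamn
  le : lamn ≤ lam2
  step_pos : 0 < α
  bound_pos : 0 < G
  accuracy_eq : δ = accuracy n lam2 lamn
  theta_eq : θ = theta n lam2 lamn α G

section Tuned

variable {lam2 lamn α G δ θ : ℝ} (h : IsTuned n lam2 lamn α G δ θ)

include h

theorem IsTuned.theta_pos : 0 < θ := by
  have := D₁_nonneg h.lam2_lt h.lt_lamn h.le
  have := h.step_pos
  have := h.bound_pos
  rw [h.theta_eq, theta]
  positivity

theorem IsTuned.accuracy_lt : 0 < δ ∧ 0 < 1 - 2 * δ := by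
  have h1 := two_le_D₂ h.lam2_lt h.lt_lamn h.le
  have h2 : (2 : ℝ) ≤ n := by exact_mod_cast h.two_le
  have h3 : 0 < 12 * n * D₂ lam2 lamn := by positivity
  rw [h.accuracy_eq, accuracy]
  refine ⟨by positivity, ?_⟩
  rw [sub_pos, mul_one_div, div_lt_one (by positivity)]
  linarith

theorem IsTuned.modulus_pos : 0 < modulus θ δ :=
  div_pos (mul_pos two_pos h.theta_pos) h.accuracy_lt.2

theorem IsTuned.theta_add : θ + modulus θ δ * δ = modulus θ δ / 2 := by
  have := h.accuracy_lt.2.ne'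
  rw [modulus]
  field_simp
  ring

/-- This is what δ is tuned for: the error `B_θ δ`, amplified by `n D₂`, uses up exactly a sixth of
θ. -/
theorem IsTuned.error_eq : n * D₂ lam2 lamn * (modulus θ δ * δ) = θ / 6 := by
  have h1 := two_le_D₂ h.lam2_lt h.lt_lamn h.le
  have h2 : (2 : ℝ) ≤ n := by exact_mod_cast h.two_le
  have h3 : 0 < n * D₂ lam2 lamn := by positivity
  have h4 := h.accuracy_lt.2.ne'
  have h5 : δ * (12 * n * D₂ lam2 lamn + 2) = 1 := by
    rw [h.accuracy_eq, accuracy]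
    exact one_div_mul_cancel (by positivity)
  rw [modulus]
  field_simp
  linear_combination θ * h5

/-- θ itself grows with n, but `error_eq` divides it by n again; 8/(6n) ≤ 2/3 then removes n, so the
final constant is free of it. -/
theorem IsTuned.radius_le :
    3 * D₁ lam2 lamn * (α * G) + 5 / 2 * D₂ lam2 lamn * (modulus θ δ * δ)
      ≤ α * G * (6 * D₁ lam2 lamn + 2) := by
  have h0 := D₁_nonneg h.lam2_lt h.lt_lamn h.le
  have h2 : (2 : ℝ) ≤ n := by exact_mod_cast h.two_le
  have he := h.error_eq
  have hp : 0 < α * G := mul_pos h.step_pos h.bound_pos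
  have hn : (0 : ℝ) < n := by linarith
  have hb : D₂ lam2 lamn * (modulus θ δ * δ) ≤ α * G * (D₁ lam2 lamn + 2 / 3) := by
    refine le_of_mul_le_mul_left ?_ hn
    rw [← mul_assoc, he, h.theta_eq, theta]
    nlinarith
  nlinarith [mul_nonneg hp.le h0]

variable {W : Matrix (Fin n) (Fin n) ℝ} (hW : W.IsSymm) (hds : W ∈ doublyStochastic ℝ (Fin n))
  (hl2 : sortedEigenvalue hW ⟨1, h.two_le⟩ = lam2)
  (hln : sortedEigenvalue hW ⟨n - 1, Nat.sub_one_lt_of_lt h.two_le⟩ = lamn)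
  {x γ : ℕ → Fin n → Model d} {q : ℕ → Fin n → Model d → Model d}
  (hq : ∀ k i, IsQuantizer δ (q k i)) (hx0 : x 0 = 0)
  (hx : ∀ k, x (k + 1) = communicate W (modulus θ δ) (q k) (intermediate α x γ k))

include hds hq hx0 hx

theorem shifted_add_two {k : ℕ} {c : Fin d}
    (hk : ∀ i j, |intermediate α x γ k i c - intermediate α x γ k j c| < θ) (i : Fin n) :
    shifted x (k + 2) i c = ∑ j, W j i * (2 * shifted x (k + 1) j c - shifted x k j c
        - α * (shifted γ (k + 1) j c - shifted γ k j c)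
        + (selfTerm (modulus θ δ) (message (q k j) (modulus θ δ) (intermediate α x γ k j))
          (intermediate α x γ k j) c - intermediate α x γ k j c))
      - (selfTerm (modulus θ δ) (message (q k i) (modulus θ δ) (intermediate α x γ k i))
          (intermediate α x γ k i) c - intermediate α x γ k i c) := by
  change x (k + 1) i c = _
  rw [hx k, communicate_apply hds h.modulus_pos h.theta_add (hq k) hk i]
  simp only [← intermediate_apply hx0]

include hl2 hln

theorem dispersion_le_of_forall_lt {K : ℕ} {c : Fin d}
    (hγ : ∀ k < K, ∀ i, |γ k i c| ≤ G)
    (hK : ∀ k < K, ∀ i j, |intermediate α x γ k i c - intermediate α x γ k j c| < θ) {k : ℕ}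
    (hk : k ≤ K) :
    dispersion (fun i => 2 * shifted x (k + 1) i c - shifted x k i c)
      ≤ n * (3 * D₁ lam2 lamn * (α * G) + 5 / 2 * D₂ lam2 lamn * (modulus θ δ * δ)) ^ 2 := by
  refine dispersion_extrapolation_le h.two_le hW hds hl2 hln h.lam2_lt h.lt_lamn h.step_pos.le
    h.bound_pos.le (mul_nonneg h.modulus_pos.le h.accuracy_lt.1.le)
    (X := fun k i => shifted x k i c) (Γ := fun k i => shifted γ k i c)
    (e := fun k i => selfTerm (modulus θ δ) (message (q k i) (modulus θ δ) (intermediate α x γ k i))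
          (intermediate α x γ k i) c - intermediate α x γ k i c)
    rfl ?_ rfl (fun k hk i => shifted_add_two h hds hq hx0 hx (hK k hk) i) (fun k hk i => ?_)
    (fun k hk i => abs_selfTerm_sub_le h.modulus_pos (hq k i) _ c) hk
  · funext i
    simp [shifted, hx0]
  · cases k with
    | zero => simpa [shifted] using h.bound_pos.le
    | succ k => exact hγ k hk i

theorem abs_intermediate_sub_lt {K : ℕ} {c : Fin d} (hγ : ∀ k < K, ∀ i, |γ k i c| ≤ G) :
    ∀ k < K, ∀ i j, |intermediate α x γ k i c - intermediate α x γ k j c| < θ := by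
  intro k
  induction k using Nat.strong_induction_on with
  | _ k ih =>
    intro hk i j
    have hd := dispersion_le_of_forall_lt h hW hds hl2 hln hq hx0 hx (K := k)
      (fun s hs => hγ s (hs.trans hk)) (fun s hs => ih s hs (hs.trans hk)) le_rfl
    set ρ := 3 * D₁ lam2 lamn * (α * G) + 5 / 2 * D₂ lam2 lamn * (modulus θ δ * δ) with hρ
    have h0 := D₁_nonneg h.lam2_lt h.lt_lamn h.le
    have h0' := two_le_D₂ h.lam2_lt h.lt_lamn h.le
    have hα := h.step_pos
    have hG := h.bound_pos
    have hm := h.modulus_pos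
    have hδ := h.accuracy_lt.1
    have hn : (2 : ℝ) ≤ n := by exact_mod_cast h.two_le
    have hρ0 : 0 ≤ ρ := by positivity
    have hsq := (sq_sub_le_two_mul_dispersion _ i j).trans (mul_le_mul_of_nonneg_left hd two_pos.le)
    -- The pairwise bound is 2nρ², and n ≥ 2 turns it into (nρ)².
    have hr := abs_le_of_sq_le_sq (b := n * ρ) (hsq.trans (by nlinarith [sq_nonneg ρ]))
      (by positivity)
    have hΓ : ∀ k' ≤ k + 1, ∀ i, |shifted γ k' i c| ≤ G := by
      intro k' hk' i
      cases k' with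
      | zero => simpa [shifted] using hG.le
      | succ k' => exact hγ k' (by omega) i
    have hθ : θ = 2 * (3 * D₁ lam2 lamn * n * (α * G)) + 8 * (α * G) := by
      rw [h.theta_eq, theta]
      ring
    have he := h.error_eq
    -- The budget: 3 D₁ n αG here and 4αG from the sampled gradients together make θ/2, and the
    -- quantization part is 5θ/12, so the total stays strictly below θ.
    have hnρ : n * ρ = 3 * D₁ lam2 lamn * n * (α * G) + 5 / 2 * (θ / 6) := by
      rw [← he, hρ]
      ring
    have hθ0 := h.theta_pos
    rw [intermediate_apply hx0, intermediate_apply hx0]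
    have a1 := abs_le.1 (hΓ (k + 1) le_rfl i)
    have a2 := abs_le.1 (hΓ (k + 1) le_rfl j)
    have a3 := abs_le.1 (hΓ k (by omega) i)
    have a4 := abs_le.1 (hΓ k (by omega) j)
    have hdiff : |α * ((shifted γ (k + 1) i c - shifted γ k i c)
        - (shifted γ (k + 1) j c - shifted γ k j c))| ≤ α * (4 * G) := by
      rw [abs_mul, abs_of_pos hα]
      refine mul_le_mul_of_nonneg_left (abs_le.2 ⟨?_, ?_⟩) hα.le <;> linarith
    rw [hnρ] at hr
    have b1 := abs_le.1 hr
    have b2 := abs_le.1 hdiff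
    have hαG : 0 < α * G := mul_pos hα hG
    rw [abs_lt]
    constructor <;> linarith

theorem dispersion_trajectory_le {K : ℕ} {c : Fin d} (hγ : ∀ k < K, ∀ i, |γ k i c| ≤ G) {k : ℕ}
    (hk : k ≤ K) :
    dispersion (fun i => x k i c) ≤ n * (α * G * (6 * D₁ lam2 lamn + 2)) ^ 2 := by
  have hd := fun k hk => dispersion_le_of_forall_lt h hW hds hl2 hln hq hx0 hx hγ
    (abs_intermediate_sub_lt h hW hds hl2 hln hq hx0 hx hγ) (k := k) hk
  have h0 := D₁_nonneg h.lam2_lt h.lt_lamn h.le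
  have h0' := two_le_D₂ h.lam2_lt h.lt_lamn h.le
  have hα := h.step_pos
  have hG := h.bound_pos
  have hm := h.modulus_pos
  have hδ := h.accuracy_lt.1
  refine (dispersion_le_of_extrapolation (X := fun k i => shifted x k i c) (by positivity) rfl hd
    (k + 1) (by omega)).trans ?_
  have := h.radius_le
  gcongr

theorem sum_norm_sub_average_sq_le {K : ℕ} (hγ : ∀ k < K, ∀ i c, |γ k i c| ≤ G) {k : ℕ}
    (hk : k ≤ K) :
    ∑ i, ‖x k i - average (x k)‖ ^ 2 ≤ n * (d * (α * G * (6 * D₁ lam2 lamn + 2)) ^ 2) := by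
  rw [sum_norm_sub_average_sq]
  have := Finset.sum_le_card_nsmul Finset.univ (fun c => dispersion fun i => x k i c) _
    fun c _ => dispersion_trajectory_le h hW hds hl2 hln hq hx0 hx (fun k hk i => hγ k hk i c) hk
  refine this.trans (le_of_eq ?_)
  rw [Finset.card_univ, Fintype.card_fin, nsmul_eq_mul]
  ring

theorem average_succ {K : ℕ} (hγ : ∀ k < K, ∀ i c, |γ k i c| ≤ G) {k : ℕ} (hk : k < K) :
    average (x (k + 1)) = average (x k) - α • average (γ k) := by
  ext c
  have hlt := abs_intermediate_sub_lt h hW hds hl2 hln hq hx0 hx (fun k hk i => hγ k hk i c)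
  have hsum : ∀ k < K, ∑ i, shifted x (k + 2) i c = 2 * ∑ i, shifted x (k + 1) i c
      - ∑ i, shifted x k i c - α * (∑ i, shifted γ (k + 1) i c - ∑ i, shifted γ k i c) := by
    intro k hk
    have hW1 : ∀ v : Fin n → ℝ, ∑ i, ∑ j, W j i * v j = ∑ j, v j := by
      intro v
      rw [Finset.sum_comm]
      refine Finset.sum_congr rfl fun j _ => ?_
      rw [← Finset.sum_mul, sum_row_of_mem_doublyStochastic hds j, one_mul]
    rw [Finset.sum_congr rfl fun i _ => shifted_add_two h hds hq hx0 hx (hlt k hk) i,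
      Finset.sum_sub_distrib, hW1]
    simp only [Finset.mul_sum, ← Finset.sum_sub_distrib]
    exact Finset.sum_congr rfl fun i _ => by ring
  -- The second-order recurrence for the sums says that S(k+1) - S(k) + αΓ(k) is constant in k, and
  -- it is 0 at the start.
  have hstep : ∀ k ≤ K, ∑ i, shifted x (k + 1) i c
      = ∑ i, shifted x k i c - α * ∑ i, shifted γ k i c := by
    intro k
    induction k with
    | zero => simp [shifted, hx0]
    | succ k ih =>
      intro hk
      rw [hsum k hk]
      linear_combination ih (by omega)
  have := hstep (k + 1) hk
  simp only [shifted] at this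
  rw [PiLp.sub_apply, PiLp.smul_apply, average_apply, average_apply, average_apply, this,
    smul_eq_mul]
  ring

end Tuned

end Trajectory

/-! ### Smooth functions -/

section Smooth

variable {d : ℕ} {L : ℝ} {f : Model d → ℝ}

theorem IsSmooth.continuous_gradient (h : IsSmooth L f) : Continuous (gradient f) := by
  refine (LipschitzWith.of_dist_le_mul (K := L.toNNReal) fun x y => ?_).continuous
  rw [dist_eq_norm, dist_eq_norm]
  exact (h.2 x y).trans
    (mul_le_mul_of_nonneg_right (Real.le_coe_toNNReal L) (norm_nonneg _))

/-- Along the segment, f minus its tangent and minus the quadratic term has nonpositive derivative,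
by the Lipschitz bound on the gradient. -/
theorem IsSmooth.le_add_inner (h : IsSmooth L f) (x v : Model d) :
    f (x + v) ≤ f x + inner ℝ (gradient f x) v + L / 2 * ‖v‖ ^ 2 := by
  have hd : ∀ t : ℝ, HasDerivAt (fun t : ℝ => f (x + t • v) - t * inner ℝ (gradient f x) v
      - L / 2 * ‖v‖ ^ 2 * t ^ 2)
      (inner ℝ (gradient f (x + t • v)) v - inner ℝ (gradient f x) v
        - L / 2 * ‖v‖ ^ 2 * (2 * t)) t := by
    intro t
    have h1 : HasDerivAt (fun t : ℝ => x + t • v) v t := by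
      simpa using ((hasDerivAt_id t).smul_const v).const_add x
    have h2 := (h.1 (x + t • v)).hasGradientAt.hasFDerivAt.comp_hasDerivAt t h1
    rw [InnerProductSpace.toDual_apply_apply] at h2
    refine (h2.sub ?_).sub ?_
    · simpa using (hasDerivAt_id t).mul_const (inner ℝ (gradient f x) v)
    · simpa using (hasDerivAt_pow 2 t).const_mul (L / 2 * ‖v‖ ^ 2)
  have hanti := antitoneOn_of_deriv_nonpos (convex_Icc (0 : ℝ) 1)
    (fun t _ => (hd t).continuousAt.continuousWithinAt)
    (fun t _ => (hd t).differentiableAt.differentiableWithinAt) (fun t ht => by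
      rw [interior_Icc] at ht
      rw [(hd t).deriv, ← inner_sub_left]
      have h1 := real_inner_le_norm (gradient f (x + t • v) - gradient f x) v
      have h2 := h.2 (x + t • v) x
      rw [add_sub_cancel_left, norm_smul, Real.norm_eq_abs, abs_of_pos ht.1] at h2
      have h3 := mul_le_mul_of_nonneg_right h2 (norm_nonneg v)
      nlinarith)
  have := hanti (Set.left_mem_Icc.2 zero_le_one) (Set.right_mem_Icc.2 zero_le_one) zero_le_one
  simp only [one_smul, zero_smul, add_zero, one_mul, zero_mul, sub_zero, one_pow, mul_one,
    zero_pow two_ne_zero, mul_zero] at this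
  linarith

end Smooth

section Objective

variable {n d : ℕ} {L : ℝ} {f : Fin n → Model d → ℝ}

theorem hasGradientAt_objective (h : ∀ i, IsSmooth L (f i)) (x : Model d) :
    HasGradientAt (objective f) (average fun i => gradient (f i) x) x := by
  rw [hasGradientAt_iff_hasFDerivAt, average, map_smul, map_sum]
  exact (HasFDerivAt.fun_sum fun i _ => ((h i).1 x).hasGradientAt.hasFDerivAt).const_mul _

theorem gradient_objective (h : ∀ i, IsSmooth L (f i)) (x : Model d) :
    gradient (objective f) x = average fun i => gradient (f i) x :=
  (hasGradientAt_objective h x).gradient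

theorem average_sub (x y : Fin n → Model d) :
    average (fun i => x i - y i) = average x - average y := by
  rw [average, average, average, Finset.sum_sub_distrib, smul_sub]

theorem norm_average_le (hn : 0 < n) {x : Fin n → Model d} {R : ℝ} (hx : ∀ i, ‖x i‖ ≤ R) :
    ‖average x‖ ≤ R := by
  have hn' : (0 : ℝ) < n := by exact_mod_cast hn
  have h := (norm_sum_le Finset.univ x).trans (Finset.sum_le_card_nsmul _ _ R fun i _ => hx i)
  rw [Finset.card_univ, Fintype.card_fin, nsmul_eq_mul] at h
  rw [average, norm_smul, norm_inv, Real.norm_natCast, inv_mul_le_iff₀ hn']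
  exact h

theorem norm_average_sq_le (hn : 0 < n) (x : Fin n → Model d) :
    ‖average x‖ ^ 2 ≤ (n : ℝ)⁻¹ * ∑ i, ‖x i‖ ^ 2 := by
  have hn' : (0 : ℝ) < n := by exact_mod_cast hn
  have h := pow_le_pow_left₀ (norm_nonneg _) (norm_sum_le Finset.univ x) 2
  have h' := h.trans (sq_sum_le_card_mul_sum_sq (s := Finset.univ) (f := fun i => ‖x i‖))
  rw [Finset.card_univ, Fintype.card_fin] at h'
  rw [average, norm_smul, norm_inv, Real.norm_natCast, mul_pow, pow_two (n : ℝ)⁻¹, mul_assoc]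
  refine mul_le_mul_of_nonneg_left ?_ (by positivity)
  rwa [inv_mul_le_iff₀ hn']

theorem IsSmooth.objective (hn : 0 < n) (h : ∀ i, IsSmooth L (f i)) :
    IsSmooth L (objective f) := by
  refine ⟨fun x => (hasGradientAt_objective h x).differentiableAt, fun x y => ?_⟩
  rw [gradient_objective h, gradient_objective h, ← average_sub]
  exact norm_average_le hn fun i => (h i).2 x y

theorem norm_gradient_objective_sub_sq_le (hn : 0 < n) (h : ∀ i, IsSmooth L (f i))
    (a : Model d) (y : Fin n → Model d) {M : ℝ} (hM : ∑ i, ‖y i - a‖ ^ 2 ≤ n * M) :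
    ‖gradient (MoniquaD2.objective f) a - average fun i => gradient (f i) (y i)‖ ^ 2
      ≤ L ^ 2 * M := by
  have hn' : (0 : ℝ) < n := by exact_mod_cast hn
  rw [gradient_objective h, ← average_sub]
  refine (norm_average_sq_le hn _).trans ?_
  rw [inv_mul_le_iff₀ hn']
  have h1 : ∀ i ∈ Finset.univ, ‖gradient (f i) a - gradient (f i) (y i)‖ ^ 2
      ≤ L ^ 2 * ‖y i - a‖ ^ 2 := fun i _ => by
    rw [← mul_pow, norm_sub_rev (y i)]
    exact pow_le_pow_left₀ (norm_nonneg _) ((h i).2 _ _) 2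
  refine (Finset.sum_le_sum h1).trans ?_
  rw [← Finset.mul_sum]
  nlinarith [mul_le_mul_of_nonneg_left hM (sq_nonneg L)]

theorem norm_le_of_abs_le {x : Model d} {G : ℝ} (hx : ∀ c, |x c| ≤ G) :
    ‖x‖ ≤ Real.sqrt (d * G ^ 2) := by
  rw [EuclideanSpace.norm_eq]
  refine Real.sqrt_le_sqrt ?_
  have : ∀ c ∈ Finset.univ, ‖x c‖ ^ 2 ≤ G ^ 2 := fun c _ =>
    pow_le_pow_left₀ (norm_nonneg _) (hx c) 2
  simpa [nsmul_eq_mul] using Finset.sum_le_card_nsmul _ _ _ this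

end Objective

/-! ### Measurability of the iterates -/

section Measurability

variable {A : Type*} [MeasurableSpace A] {n d : ℕ}

theorem measurable_model {F : A → Model d} (hF : ∀ c, Measurable fun a => F a c) :
    Measurable F :=
  (WithLp.measurable_toLp 2 (Fin d → ℝ)).comp (measurable_pi_lambda _ hF)

theorem Measurable.model_apply {F : A → Model d} (hF : Measurable F) (c : Fin d) :
    Measurable fun a => F a c :=
  (measurable_pi_apply c).comp ((WithLp.measurable_ofLp 2 (Fin d → ℝ)).comp hF)

theorem measurable_vmod (a : ℝ) : Measurable fun x : Model d => vmod x a := by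
  refine measurable_model fun c => ?_
  have hc : Measurable fun x : Model d => x c := Measurable.model_apply measurable_id c
  change Measurable fun x : Model d => x c - a * (⌊x c / a + 1 / 2⌋ : ℝ)
  have hf : Measurable fun x : Model d => ⌊x c / a + 1 / 2⌋ :=
    Measurable.floor (by fun_prop)
  have hf' : Measurable fun x : Model d => ((⌊x c / a + 1 / 2⌋ : ℤ) : ℝ) :=
    (measurable_from_top (f := fun z : ℤ => (z : ℝ))).comp hf
  fun_prop

theorem measurable_communicate (W : Matrix (Fin n) (Fin n) ℝ) (B : ℝ) {U : Type*}
    [MeasurableSpace U] {Q : U → Model d → Model d}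
    (hQ : Measurable fun p : U × Model d => Q p.1 p.2) {v : A → Fin n → U}
    (hv : ∀ i, Measurable fun a => v a i) {h : A → Fin n → Model d}
    (hh : ∀ i, Measurable fun a => h a i) (i : Fin n) :
    Measurable fun a => communicate W B (fun j => Q (v a j)) (h a) i := by
  have hm : ∀ j, Measurable fun a => message (Q (v a j)) B (h a j) := fun j =>
    hQ.comp ((hv j).prodMk ((measurable_vmod 1).comp ((hh j).const_smul B⁻¹)))
  have hr : ∀ j, Measurable fun a => recovered B (message (Q (v a j)) B (h a j)) (h a i) :=
    fun j => ((measurable_vmod B).comp (((hm j).const_smul B).sub (hh i))).add (hh i)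
  have hs : Measurable fun a => selfTerm B (message (Q (v a i)) B (h a i)) (h a i) :=
    (((hm i).const_smul B).sub ((measurable_vmod B).comp (hh i))).add (hh i)
  exact (hh i).add (Finset.measurable_fun_sum _ fun j _ => ((hr j).sub hs).const_smul (W j i))

theorem measurable_iterates (W : Matrix (Fin n) (Fin n) ℝ) (B α : ℝ) {Ξ U : Type*}
    [MeasurableSpace Ξ] [MeasurableSpace U] {g : Fin n → Model d → Ξ → Model d}
    (hg : ∀ i, Measurable fun p : Model d × Ξ => g i p.1 p.2) {Q : U → Model d → Model d}
    (hQ : Measurable fun p : U × Model d => Q p.1 p.2) {s : A → ℕ → Fin n → Ξ}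
    (hs : ∀ t i, Measurable fun a => s a t i) {u : A → ℕ → Fin n → U}
    (hu : ∀ t i, Measurable fun a => u a t i) :
    ∀ k i, Measurable fun a => iterates W B α g Q (s a) (u a) k i
  | 0, i => by
    simp only [iterates]
    exact measurable_const
  | 1, i => by
    have h0 := measurable_iterates W B α hg hQ hs hu 0
    have hγ : ∀ i, Measurable fun a => g i (iterates W B α g Q (s a) (u a) 0 i) (s a 0 i) :=
      fun i => (hg i).comp ((h0 i).prodMk (hs 0 i))
    simp only [iterates_succ]
    exact measurable_communicate W B hQ (hu 0)
      (fun i => (h0 i).sub ((hγ i).const_smul α)) i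
  | k + 2, i => by
    have h0 := measurable_iterates W B α hg hQ hs hu k
    have h1 := measurable_iterates W B α hg hQ hs hu (k + 1)
    have hγ0 : ∀ i, Measurable fun a => g i (iterates W B α g Q (s a) (u a) k i) (s a k i) :=
      fun i => (hg i).comp ((h0 i).prodMk (hs k i))
    have hγ1 : ∀ i, Measurable fun a =>
        g i (iterates W B α g Q (s a) (u a) (k + 1) i) (s a (k + 1) i) :=
      fun i => (hg i).comp ((h1 i).prodMk (hs (k + 1) i))
    simp only [iterates_succ]
    exact measurable_communicate W B hQ (hu (k + 1))
      (fun i => ((((h1 i).const_smul (2 : ℝ)).sub (h0 i)).sub ((hγ1 i).const_smul α)).add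
        ((hγ0 i).const_smul α)) i

theorem iterates_congr (W : Matrix (Fin n) (Fin n) ℝ) (B α : ℝ) {Ξ U : Type*}
    (g : Fin n → Model d → Ξ → Model d) (Q : U → Model d → Model d) {s s' : ℕ → Fin n → Ξ}
    {u u' : ℕ → Fin n → U} : ∀ k, (∀ t < k, s t = s' t) → (∀ t < k, u t = u' t) →
      iterates W B α g Q s u k = iterates W B α g Q s' u' k
  | 0, _, _ => rfl
  | 1, hs, hu => by simp only [iterates, hs 0 one_pos, hu 0 one_pos]
  | k + 2, hs, hu => by
    have h0 := iterates_congr W B α g Q k (fun t ht => hs t (by omega)) fun t ht => hu t (by omega)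
    have h1 := iterates_congr W B α g Q (k + 1) (fun t ht => hs t (by omega))
      fun t ht => hu t (by omega)
    simp only [iterates, h0, h1, hs (k + 1) (by omega), hs k (by omega), hu (k + 1) (by omega)]

end Measurability

/-! ### Independence of the past and the current samples -/

/-- Needed for the noise cross terms: the models together with worker j's sample must be independent
of worker i's sample. Both joint laws are the same triple product up to reassociation. -/
theorem IndepFun.prodMk_left_of_prodMk_right {Ω β γ κ : Type*} [MeasurableSpace Ω]
    [MeasurableSpace β] [MeasurableSpace γ] [MeasurableSpace κ] {P : Measure Ω}
    [IsProbabilityMeasure P] {Y : Ω → β} {b : Ω → γ} {c : Ω → κ} (hY : Measurable Y)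
    (hb : Measurable b) (hc : Measurable c) (h : IndepFun Y (fun ω => (b ω, c ω)) P)
    (hbc : IndepFun b c P) : IndepFun (fun ω => (Y ω, b ω)) c P := by
  have hYb : IndepFun Y b P := h.comp measurable_id measurable_fst
  have h1 := (indepFun_iff_map_prod_eq_prod_map_map hY.aemeasurable
    (hb.prodMk hc).aemeasurable).1 h
  have h2 := (indepFun_iff_map_prod_eq_prod_map_map hb.aemeasurable hc.aemeasurable).1 hbc
  have h3 := (indepFun_iff_map_prod_eq_prod_map_map hY.aemeasurable hb.aemeasurable).1 hYb
  rw [indepFun_iff_map_prod_eq_prod_map_map (hY.prodMk hb).aemeasurable hc.aemeasurable, h3]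
  have := Measure.isProbabilityMeasure_map (μ := P) hY.aemeasurable
  have := Measure.isProbabilityMeasure_map (μ := P) hb.aemeasurable
  have := Measure.isProbabilityMeasure_map (μ := P) hc.aemeasurable
  have h4 : P.map (fun ω => ((Y ω, b ω), c ω))
      = (P.map (fun ω => (Y ω, (b ω, c ω)))).map MeasurableEquiv.prodAssoc.symm := by
    rw [Measure.map_map MeasurableEquiv.prodAssoc.symm.measurable (hY.prodMk (hb.prodMk hc))]
    rfl
  rw [h4, h1, h2, ← Measure.prodAssoc_prod, Measure.map_map
    MeasurableEquiv.prodAssoc.symm.measurable MeasurableEquiv.prodAssoc.measurable]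
  simp

section Sampling

variable {n d : ℕ} {Ω Ξ U : Type*} [MeasurableSpace Ω] [MeasurableSpace Ξ] [MeasurableSpace U]
  {P : Measure Ω} [IsProbabilityMeasure P] {D : Fin n → Measure Ξ}
  {g : Fin n → Model d → Ξ → Model d} {ξ : ℕ → Fin n → Ω → Ξ} {u : ℕ → Fin n → Ω → U}
  {Q : U → Model d → Model d}

theorem IsSampling.indepFun_iterates (hs : IsSampling P D ξ u)
    (W : Matrix (Fin n) (Fin n) ℝ) (B α : ℝ)
    (hg : ∀ i, Measurable fun p : Model d × Ξ => g i p.1 p.2)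
    (hQ : Measurable fun p : U × Model d => Q p.1 p.2) (k : ℕ) :
    IndepFun (fun ω => iterates W B α g Q (fun t j => ξ t j ω) (fun t j => u t j ω) k)
      (fun ω i => ξ k i ω) P := by
  obtain ⟨ω₀⟩ : Nonempty Ω := P.nonempty_of_neZero
  have hi := hs.indep_iterations.indepFun_finset (Finset.range k) {k}
    (by simp) (fun t => measurable_pi_lambda _ fun i =>
      (hs.measurable_data t i).prodMk (hs.measurable_seed t i))
  let past := ↥(Finset.range k) → Fin n → Ξ × U
  -- The iterates at time k depend only on rounds before k; later rounds are filled with the values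
  -- at a fixed ω₀, merely to obtain a function of the past alone.
  let s : past → ℕ → Fin n → Ξ := fun p t i =>
    if h : t ∈ Finset.range k then (p ⟨t, h⟩ i).1 else ξ t i ω₀
  let v : past → ℕ → Fin n → U := fun p t i =>
    if h : t ∈ Finset.range k then (p ⟨t, h⟩ i).2 else u t i ω₀
  have hsm : ∀ t i, Measurable fun p : past => s p t i := fun t i => by
    by_cases h : t ∈ Finset.range k
    · simp only [s, dif_pos h]
      exact measurable_fst.comp ((measurable_pi_apply i).comp (measurable_pi_apply _))
    · simp only [s, dif_neg h]
      exact measurable_const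
  have hvm : ∀ t i, Measurable fun p : past => v p t i := fun t i => by
    by_cases h : t ∈ Finset.range k
    · simp only [v, dif_pos h]
      exact measurable_snd.comp ((measurable_pi_apply i).comp (measurable_pi_apply _))
    · simp only [v, dif_neg h]
      exact measurable_const
  have hΦ : Measurable fun p : past => iterates W B α g Q (s p) (v p) k :=
    measurable_pi_lambda _ fun i => measurable_iterates W B α hg hQ hsm hvm k i
  have hΨ : Measurable fun (p : ↥({k} : Finset ℕ) → Fin n → Ξ × U) (i : Fin n) =>
      (p ⟨k, Finset.mem_singleton_self k⟩ i).1 :=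
    measurable_pi_lambda _ fun i =>
      measurable_fst.comp ((measurable_pi_apply i).comp (measurable_pi_apply _))
  convert hi.comp hΦ hΨ using 1
  · funext ω
    refine iterates_congr W B α g Q k (fun t ht => ?_) fun t ht => ?_
    · funext i
      simp [s, ht]
    · funext i
      simp [v, ht]
  · rfl

end Sampling

/-! ### Essentially bounded random variables -/

/-- `X` is measurable and almost surely bounded. -/
def IsEssBounded {Ω E : Type*} [MeasurableSpace Ω] [NormedAddCommGroup E] [MeasurableSpace E]
    (P : Measure Ω) (X : Ω → E) : Prop :=
  Measurable X ∧ ∃ C : ℝ, ∀ᵐ ω ∂P, ‖X ω‖ ≤ C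

section EssBounded

variable {Ω : Type*} [MeasurableSpace Ω] {P : Measure Ω} {n d : ℕ}

theorem IsEssBounded.integrable [IsFiniteMeasure P] {X : Ω → ℝ} (h : IsEssBounded P X) :
    Integrable X P :=
  let ⟨C, hC⟩ := h.2
  Integrable.of_bound h.1.aestronglyMeasurable C hC

theorem IsEssBounded.add {X Y : Ω → Model d} (hX : IsEssBounded P X) (hY : IsEssBounded P Y) :
    IsEssBounded P fun ω => X ω + Y ω := by
  obtain ⟨a, ha⟩ := hX.2
  obtain ⟨b, hb⟩ := hY.2
  refine ⟨hX.1.add hY.1, a + b, ?_⟩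
  filter_upwards [ha, hb] with ω h1 h2
  exact (norm_add_le _ _).trans (add_le_add h1 h2)

theorem IsEssBounded.const_smul {X : Ω → Model d} (hX : IsEssBounded P X) (c : ℝ) :
    IsEssBounded P fun ω => c • X ω := by
  obtain ⟨a, ha⟩ := hX.2
  refine ⟨hX.1.const_smul c, |c| * a, ?_⟩
  filter_upwards [ha] with ω h1
  rw [norm_smul, Real.norm_eq_abs]
  exact mul_le_mul_of_nonneg_left h1 (abs_nonneg c)

theorem IsEssBounded.sub {X Y : Ω → Model d} (hX : IsEssBounded P X) (hY : IsEssBounded P Y) :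
    IsEssBounded P fun ω => X ω - Y ω := by
  simpa [sub_eq_add_neg] using hX.add (hY.const_smul (-1))

theorem IsEssBounded.average {X : Fin n → Ω → Model d} (hX : ∀ i, IsEssBounded P (X i)) :
    IsEssBounded P fun ω => average fun i => X i ω := by
  have : ∀ s : Finset (Fin n), IsEssBounded P fun ω => ∑ i ∈ s, X i ω := by
    intro s
    induction s using Finset.induction_on with
    | empty => exact ⟨by simp, 0, by simp⟩
    | insert i s hi ih => simpa only [Finset.sum_insert hi] using (hX i).add ih
  exact (this Finset.univ).const_smul _

theorem IsEssBounded.inner {X Y : Ω → Model d} (hX : IsEssBounded P X) (hY : IsEssBounded P Y) :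
    IsEssBounded P fun ω => inner ℝ (X ω) (Y ω) := by
  obtain ⟨a, ha⟩ := hX.2
  obtain ⟨b, hb⟩ := hY.2
  refine ⟨hX.1.inner hY.1, a * b, ?_⟩
  filter_upwards [ha, hb] with ω h1 h2
  exact (norm_inner_le_norm _ _).trans
    (mul_le_mul h1 h2 (norm_nonneg _) ((norm_nonneg _).trans h1))

theorem IsEssBounded.norm_sq {X : Ω → Model d} (hX : IsEssBounded P X) :
    IsEssBounded P fun ω => ‖X ω‖ ^ 2 := by
  simpa only [real_inner_self_eq_norm_sq] using hX.inner hX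

/-- Closed balls of the model space are compact, so a continuous function is bounded on the range of
an essentially bounded model. This supplies the integrability of objectives and gradients. -/
theorem IsEssBounded.continuous_comp {E : Type*} [NormedAddCommGroup E] [MeasurableSpace E]
    [BorelSpace E] {X : Ω → Model d} (hX : IsEssBounded P X) {f : Model d → E}
    (hf : Continuous f) : IsEssBounded P fun ω => f (X ω) := by
  obtain ⟨a, ha⟩ := hX.2
  obtain ⟨C, hC⟩ := (isCompact_closedBall (0 : Model d) a).exists_bound_of_continuousOn
    hf.continuousOn
  refine ⟨hf.measurable.comp hX.1, C, ?_⟩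
  filter_upwards [ha] with ω h1
  exact hC _ (by simpa using h1)

end EssBounded

/-! ### The sampling noise -/

section Noise

variable {Ω Ξ S : Type*} [MeasurableSpace Ω] [MeasurableSpace Ξ] [MeasurableSpace S]
  {P : Measure Ω} [IsProbabilityMeasure P] {D : Measure Ξ} {d : ℕ} {σ L : ℝ}
  {f : Model d → ℝ} {g : Model d → Ξ → Model d}

theorem IsStochasticGradient.measurable_noise (hg : IsStochasticGradient D σ f g)
    (hf : IsSmooth L f) : Measurable fun p : Model d × Ξ => g p.1 p.2 - gradient f p.1 :=
  hg.measurable.sub (hf.continuous_gradient.measurable.comp measurable_fst)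

/-- By independence the joint law is a product, and for fixed z the inner integral vanishes by
unbiasedness. -/
theorem integral_inner_noise_eq_zero (hg : IsStochasticGradient D σ f g) (hf : IsSmooth L f)
    {Z : Ω → S} {ζ : Ω → Ξ} (hZ : Measurable Z) (hζ : Measurable ζ) (hD : P.map ζ = D)
    (hi : IndepFun Z ζ P) {V y : S → Model d} (hV : Measurable V) (hy : Measurable y)
    (hint : Integrable
      (fun ω => inner ℝ (V (Z ω)) (g (y (Z ω)) (ζ ω) - gradient f (y (Z ω)))) P) :
    ∫ ω, inner ℝ (V (Z ω)) (g (y (Z ω)) (ζ ω) - gradient f (y (Z ω))) ∂P = 0 := by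
  have hprod := (indepFun_iff_map_prod_eq_prod_map_map hZ.aemeasurable hζ.aemeasurable).1 hi
  have : IsProbabilityMeasure (P.map Z) := Measure.isProbabilityMeasure_map hZ.aemeasurable
  have : IsProbabilityMeasure D := hD ▸ Measure.isProbabilityMeasure_map hζ.aemeasurable
  rw [hD] at hprod
  let F : S × Ξ → ℝ := fun p => inner ℝ (V p.1) (g (y p.1) p.2 - gradient f (y p.1))
  have hF : Measurable F := (hV.comp measurable_fst).inner
    ((hg.measurable_noise hf).comp ((hy.comp measurable_fst).prodMk measurable_snd))
  have hZζ := hZ.prodMk hζ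
  have hintF : Integrable F ((P.map Z).prod D) := by
    rw [← hprod, integrable_map_measure hF.aestronglyMeasurable hZζ.aemeasurable]
    exact hint
  have h1 : ∫ ω, inner ℝ (V (Z ω)) (g (y (Z ω)) (ζ ω) - gradient f (y (Z ω))) ∂P
      = ∫ p, F p ∂((P.map Z).prod D) := by
    rw [← hprod, integral_map hZζ.aemeasurable hF.aestronglyMeasurable]
  rw [h1, integral_prod F hintF]
  refine integral_eq_zero_of_ae (Filter.Eventually.of_forall fun z => ?_)
  have h2 : Integrable (fun x => g (y z) x - gradient f (y z)) D :=
    (hg.integrable (y z)).sub (integrable_const _)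
  change ∫ x, inner ℝ (V z) (g (y z) x - gradient f (y z)) ∂D = 0
  rw [integral_inner h2, integral_sub (hg.integrable (y z)) (integrable_const _), hg.unbiased]
  simp

theorem integral_norm_noise_sq_le (hg : IsStochasticGradient D σ f g) (hf : IsSmooth L f)
    {Y : Ω → Model d} {ζ : Ω → Ξ} (hY : Measurable Y) (hζ : Measurable ζ) (hD : P.map ζ = D)
    (hi : IndepFun Y ζ P) : ∫ ω, ‖g (Y ω) (ζ ω) - gradient f (Y ω)‖ ^ 2 ∂P ≤ σ ^ 2 := by
  have hprod := (indepFun_iff_map_prod_eq_prod_map_map hY.aemeasurable hζ.aemeasurable).1 hi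
  have : IsProbabilityMeasure (P.map Y) := Measure.isProbabilityMeasure_map hY.aemeasurable
  have : IsProbabilityMeasure D := hD ▸ Measure.isProbabilityMeasure_map hζ.aemeasurable
  rw [hD] at hprod
  have hm := hg.measurable_noise hf
  have hYζ := hY.prodMk hζ
  have hmc : Measurable fun ω => g (Y ω) (ζ ω) - gradient f (Y ω) := hm.comp hYζ
  have hm2 : Measurable fun p : Model d × Ξ =>
      ENNReal.ofReal (‖g p.1 p.2 - gradient f p.1‖ ^ 2) := (hm.norm.pow_const 2).ennreal_ofReal
  rw [integral_eq_lintegral_of_nonneg_ae (Filter.Eventually.of_forall fun ω => sq_nonneg _)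
    (hmc.norm.pow_const 2).aestronglyMeasurable]
  refine ENNReal.toReal_le_of_le_ofReal (sq_nonneg σ) ?_
  have h1 : ∫⁻ ω, ENNReal.ofReal (‖g (Y ω) (ζ ω) - gradient f (Y ω)‖ ^ 2) ∂P
      = ∫⁻ p, ENNReal.ofReal (‖g p.1 p.2 - gradient f p.1‖ ^ 2) ∂((P.map Y).prod D) := by
    rw [← hprod, lintegral_map hm2 hYζ]
  rw [h1, lintegral_prod _ hm2.aemeasurable]
  refine (lintegral_mono fun y => hg.variance_le y).trans ?_
  simp

end Noise

/-! ### The expected descent in one iteration -/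

section Descent

variable {Ω Ξ : Type*} [MeasurableSpace Ω] [MeasurableSpace Ξ] {P : Measure Ω}
  [IsProbabilityMeasure P] {n d : ℕ} {D : Fin n → Measure Ξ} {σ L : ℝ}
  {f : Fin n → Model d → ℝ} {g : Fin n → Model d → Ξ → Model d}

theorem integral_norm_average_noise_sq_le (hn : 0 < n)
    (hg : ∀ i, IsStochasticGradient (D i) σ (f i) (g i)) (hf : ∀ i, IsSmooth L (f i))
    {Y : Fin n → Ω → Model d} {ζ : Fin n → Ω → Ξ} (hY : ∀ i, Measurable (Y i))
    (hζ : ∀ i, Measurable (ζ i)) (hD : ∀ i, P.map (ζ i) = D i)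
    (hi : IndepFun (fun ω i => Y i ω) (fun ω i => ζ i ω) P) (hw : iIndepFun ζ P)
    (hN : ∀ i, IsEssBounded P fun ω => g i (Y i ω) (ζ i ω) - gradient (f i) (Y i ω)) :
    ∫ ω, ‖average fun i => g i (Y i ω) (ζ i ω) - gradient (f i) (Y i ω)‖ ^ 2 ∂P
      ≤ σ ^ 2 / n := by
  set N : Fin n → Ω → Model d := fun i ω => g i (Y i ω) (ζ i ω) - gradient (f i) (Y i ω) with hNd
  have hn' : (0 : ℝ) < n := by exact_mod_cast hn
  have hYm : Measurable fun ω i => Y i ω := measurable_pi_lambda _ hY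
  have h1 : ∀ ω, ‖average fun i => N i ω‖ ^ 2
      = ((n : ℝ)⁻¹) ^ 2 * ∑ i, ∑ j, inner ℝ (N j ω) (N i ω) := by
    intro ω
    rw [average, norm_smul, norm_inv, Real.norm_natCast, mul_pow,
      ← real_inner_self_eq_norm_sq (∑ i, N i ω), inner_sum]
    simp only [sum_inner]
  -- Conditionally on all models and on worker j's sample, worker i's noise is still centred. Only
  -- the n diagonal terms remain, which gives σ²/n.
  have hzero : ∀ i j, j ≠ i → ∫ ω, inner ℝ (N j ω) (N i ω) ∂P = 0 := by
    intro i j hji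
    have hij : IndepFun (fun ω => ((fun i => Y i ω), ζ j ω)) (ζ i) P := by
      refine IndepFun.prodMk_left_of_prodMk_right hYm (hζ j) (hζ i) ?_ (hw.indepFun hji)
      exact hi.comp measurable_id ((measurable_pi_apply j).prodMk (measurable_pi_apply i))
    have hVm : Measurable fun p : (Fin n → Model d) × Ξ =>
        g j (p.1 j) p.2 - gradient (f j) (p.1 j) := by
      have hp : Measurable fun p : (Fin n → Model d) × Ξ => (p.1 j, p.2) :=
        ((measurable_pi_apply j).comp measurable_fst).prodMk measurable_snd
      exact ((hg j).measurable_noise (hf j)).comp hp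
    exact integral_inner_noise_eq_zero (hg i) (hf i) (hYm.prodMk (hζ j)) (hζ i) (hD i) hij
      (y := fun p => p.1 i) hVm
      ((measurable_pi_apply i).comp measurable_fst) ((hN j).inner (hN i)).integrable
  have hdiag : ∀ i, ∫ ω, inner ℝ (N i ω) (N i ω) ∂P ≤ σ ^ 2 := by
    intro i
    simp only [real_inner_self_eq_norm_sq]
    exact integral_norm_noise_sq_le (hg i) (hf i) (hY i) (hζ i) (hD i)
      (hi.comp (measurable_pi_apply i) (measurable_pi_apply i))
  have hint : ∀ i j, Integrable (fun ω => inner ℝ (N j ω) (N i ω)) P := fun i j =>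
    ((hN j).inner (hN i)).integrable
  refine (integral_congr_ae (Filter.Eventually.of_forall h1)).trans_le ?_
  rw [integral_const_mul, integral_finsetSum _ fun i _ => integrable_finsetSum _ fun j _ => hint i j]
  have h2 : ∀ i ∈ Finset.univ, ∫ ω, ∑ j, inner ℝ (N j ω) (N i ω) ∂P ≤ σ ^ 2 := by
    intro i _
    rw [integral_finsetSum _ fun j _ => hint i j,
      Finset.sum_eq_single i (fun j _ hj => hzero i j hj) (by simp)]
    exact hdiag i
  have h3 := Finset.sum_le_card_nsmul _ _ _ h2
  rw [Finset.card_univ, Fintype.card_fin, nsmul_eq_mul] at h3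
  refine (mul_le_mul_of_nonneg_left h3 (by positivity)).trans (le_of_eq ?_)
  field_simp

theorem integral_inner_average_noise_eq_zero
    (hg : ∀ i, IsStochasticGradient (D i) σ (f i) (g i)) (hf : ∀ i, IsSmooth L (f i))
    {Y : Fin n → Ω → Model d} {ζ : Fin n → Ω → Ξ} (hY : ∀ i, Measurable (Y i))
    (hζ : ∀ i, Measurable (ζ i)) (hD : ∀ i, P.map (ζ i) = D i)
    (hi : IndepFun (fun ω i => Y i ω) (fun ω i => ζ i ω) P)
    (hN : ∀ i, IsEssBounded P fun ω => g i (Y i ω) (ζ i ω) - gradient (f i) (Y i ω))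
    {V : (Fin n → Model d) → Model d} (hV : Measurable V)
    (hVb : IsEssBounded P fun ω => V fun i => Y i ω) :
    ∫ ω, inner ℝ (V fun i => Y i ω)
      (average fun i => g i (Y i ω) (ζ i ω) - gradient (f i) (Y i ω)) ∂P = 0 := by
  have hYm : Measurable fun ω i => Y i ω := measurable_pi_lambda _ hY
  simp only [average, real_inner_smul_right, inner_sum]
  rw [integral_const_mul, integral_finsetSum _ fun i _ => (hVb.inner (hN i)).integrable,
    Finset.sum_eq_zero fun i _ => ?_, mul_zero]
  exact integral_inner_noise_eq_zero (hg i) (hf i) hYm (hζ i) (hD i)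
    (hi.comp measurable_id (measurable_pi_apply i)) hV (measurable_pi_apply i)
    (hVb.inner (hN i)).integrable

/-- Polarization turns -α⟨∇F(a), m⟩ into -α/2 ‖∇F(a)‖² - α/2 ‖m‖² plus the mismatch; αL ≤ 1 lets the
negative ‖m‖² absorb the quadratic term. All terms linear in N are collected against one vector that
depends on the models only. -/
theorem IsSmooth.descent {F : Model d → ℝ} (hF : IsSmooth L F) {α M : ℝ} (hα : 0 < α)
    (hαL : α * L ≤ 1) (a m N : Model d) (hM : ‖gradient F a - m‖ ^ 2 ≤ L ^ 2 * M) :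
    F (a - α • (m + N)) ≤ F a - α / 2 * ‖gradient F a‖ ^ 2 + α / 2 * (L ^ 2 * M)
      + inner ℝ (-α • gradient F a + (L * α ^ 2) • m) N + L / 2 * α ^ 2 * ‖N‖ ^ 2 := by
  have h := hF.le_add_inner a (-(α • (m + N)))
  rw [← sub_eq_add_neg, norm_neg, norm_smul, mul_pow, Real.norm_eq_abs, sq_abs,
    norm_add_sq_real, inner_neg_right, real_inner_smul_right, inner_add_right] at h
  rw [norm_sub_sq_real] at hM
  rw [inner_add_left, real_inner_smul_left, real_inner_smul_left]
  have h1 : L * α ^ 2 * ‖m‖ ^ 2 ≤ α * ‖m‖ ^ 2 := by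
    have : L * α ^ 2 ≤ α := by nlinarith
    exact mul_le_mul_of_nonneg_right this (sq_nonneg _)
  nlinarith [mul_le_mul_of_nonneg_left hM hα.le]

theorem integral_objective_step_le (hn : 0 < n)
    (hg : ∀ i, IsStochasticGradient (D i) σ (f i) (g i)) (hf : ∀ i, IsSmooth L (f i))
    {Y : Fin n → Ω → Model d} {ζ : Fin n → Ω → Ξ} (hY : ∀ i, IsEssBounded P (Y i))
    (hζ : ∀ i, Measurable (ζ i)) (hD : ∀ i, P.map (ζ i) = D i)
    (hi : IndepFun (fun ω i => Y i ω) (fun ω i => ζ i ω) P) (hw : iIndepFun ζ P)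
    (hγ : ∀ i, IsEssBounded P fun ω => g i (Y i ω) (ζ i ω)) {α M : ℝ} (hα : 0 < α)
    (hL : 0 ≤ L) (hαL : α * L ≤ 1)
    (hM : ∀ᵐ ω ∂P, ∑ i, ‖Y i ω - average fun j => Y j ω‖ ^ 2 ≤ n * M)
    {A : Ω → Model d} (hA : IsEssBounded P A)
    (hstep : ∀ᵐ ω ∂P, A ω = (average fun i => Y i ω) - α • average fun i => g i (Y i ω) (ζ i ω)) :
    ∫ ω, objective f (A ω) ∂P ≤ ∫ ω, objective f (average fun i => Y i ω) ∂P
      - α / 2 * ∫ ω, ‖gradient (objective f) (average fun i => Y i ω)‖ ^ 2 ∂P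
      + α / 2 * (L ^ 2 * M) + L / 2 * α ^ 2 * (σ ^ 2 / n) := by
  have hF := IsSmooth.objective hn hf
  set F := objective f with hFd
  have hFc : Continuous F := hF.1.continuous
  have hgi : ∀ i, IsEssBounded P fun ω => gradient (f i) (Y i ω) := fun i =>
    (hY i).continuous_comp (hf i).continuous_gradient
  have hN : ∀ i, IsEssBounded P fun ω => g i (Y i ω) (ζ i ω) - gradient (f i) (Y i ω) :=
    fun i => (hγ i).sub (hgi i)
  have hav : IsEssBounded P fun ω => average fun i => Y i ω := IsEssBounded.average hY
  have hp : IsEssBounded P fun ω => gradient F (average fun i => Y i ω) :=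
    hav.continuous_comp hF.continuous_gradient
  let V : (Fin n → Model d) → Model d := fun y =>
    -α • gradient F (average y) + (L * α ^ 2) • average fun i => gradient (f i) (y i)
  have hV : Measurable V := by
    have hc : Continuous V := by
      have h1 : Continuous fun y : Fin n → Model d => average y := by
        simp only [average]
        fun_prop
      have h2 : Continuous fun y : Fin n → Model d => average fun i => gradient (f i) (y i) :=
        h1.comp (continuous_pi fun i => (hf i).continuous_gradient.comp (continuous_apply i))
      exact ((hF.continuous_gradient.comp h1).const_smul (-α)).add (h2.const_smul (L * α ^ 2))
    exact hc.measurable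
  have hVb : IsEssBounded P fun ω => V fun i => Y i ω :=
    (hp.const_smul _).add ((IsEssBounded.average hgi).const_smul _)
  have hNav := IsEssBounded.average hN
  have i1 : Integrable (fun ω => F (average fun i => Y i ω)) P :=
    (hav.continuous_comp hFc).integrable
  have i2 := hp.norm_sq.integrable
  have i3 := (hVb.inner hNav).integrable
  have i4 := hNav.norm_sq.integrable
  have hpt : ∀ᵐ ω ∂P, F (A ω) ≤ F (average fun i => Y i ω)
      - α / 2 * ‖gradient F (average fun i => Y i ω)‖ ^ 2 + α / 2 * (L ^ 2 * M)
      + inner ℝ (V fun i => Y i ω)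
        (average fun i => g i (Y i ω) (ζ i ω) - gradient (f i) (Y i ω))
      + L / 2 * α ^ 2
        * ‖average fun i => g i (Y i ω) (ζ i ω) - gradient (f i) (Y i ω)‖ ^ 2 := by
    filter_upwards [hM, hstep] with ω h1 h2
    have h3 := hF.descent hα hαL (average fun i => Y i ω)
      (average fun i => gradient (f i) (Y i ω))
      (average fun i => g i (Y i ω) (ζ i ω) - gradient (f i) (Y i ω))
      (norm_gradient_objective_sub_sq_le hn hf _ (fun i => Y i ω) h1)
    have h4 : (average fun i => gradient (f i) (Y i ω))
        + (average fun i => g i (Y i ω) (ζ i ω) - gradient (f i) (Y i ω))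
        = average fun i => g i (Y i ω) (ζ i ω) := by
      rw [average_sub, add_sub_cancel]
    rw [h4, ← h2] at h3
    exact h3
  have j2 := i2.const_mul (α / 2)
  have j4 := i4.const_mul (L / 2 * α ^ 2)
  have h := integral_mono_ae (hA.continuous_comp hFc).integrable
    ((((i1.sub j2).add (integrable_const (α / 2 * (L ^ 2 * M)))).add i3).add j4) hpt
  rw [integral_add' (((i1.sub j2).add (integrable_const _)).add i3) j4,
    integral_add' ((i1.sub j2).add (integrable_const _)) i3,
    integral_add' (i1.sub j2) (integrable_const _), integral_sub' i1 j2, integral_const,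
    probReal_univ, one_smul, integral_const_mul, integral_const_mul,
    integral_inner_average_noise_eq_zero hg hf (fun i => (hY i).1) hζ hD hi hN hV hVb] at h
  have hvar := integral_norm_average_noise_sq_le hn hg hf (fun i => (hY i).1) hζ hD hi hw hN
  have hc : 0 ≤ L / 2 * α ^ 2 := by positivity
  have := mul_le_mul_of_nonneg_left hvar hc
  linarith

end Descent

/-! ### The convergence rate -/

section Rate

theorem mul_sum_le_of_descent {a b : ℕ → ℝ} {c e : ℝ} :
    ∀ K : ℕ, (∀ k < K, b (k + 1) ≤ b k - c * a k + e) →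
      c * ∑ k ∈ Finset.range K, a k ≤ b 0 - b K + K * e
  | 0, _ => by simp
  | K + 1, h => by
    have ih := mul_sum_le_of_descent K fun k hk => h k (by omega)
    have := h K (by omega)
    rw [Finset.sum_range_succ]
    push_cast
    linarith

variable {n K : ℕ} {σ L : ℝ}

theorem stepSize_pos (hσ : 0 ≤ σ) (hL : 0 < L) : 0 < stepSize n K σ L := by
  rw [stepSize]
  positivity

theorem stepSize_mul_le (hσ : 0 ≤ σ) (hL : 0 < L) :
    stepSize n K σ L * (σ * Real.sqrt (K / n)) ≤ 1 ∧ stepSize n K σ L * (2 * L) ≤ 1 := by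
  have h0 : 0 ≤ σ * Real.sqrt (K / n) := by positivity
  rw [stepSize, one_div_mul_eq_div, one_div_mul_eq_div]
  constructor <;> rw [div_le_one (by positivity)] <;> linarith

theorem sq_mul_stepSize_sq_le (hn : 0 < n) (hσ : 0 ≤ σ) (hL : 0 < L) :
    L ^ 2 * stepSize n K σ L ^ 2 ≤ (L ^ 2 + 1 / 4) * (n / (σ ^ 2 * K + n)) := by
  have hn' : (0 : ℝ) < n := by exact_mod_cast hn
  obtain ⟨h1, h2⟩ := stepSize_mul_le (n := n) (K := K) hσ hL
  have h0 := stepSize_pos (n := n) (K := K) hσ hL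
  set α := stepSize n K σ L
  have h3 : α ^ 2 * (σ ^ 2 * K) ≤ n := by
    have h := pow_le_one₀ (n := 2) (by positivity) h1
    rw [mul_pow, mul_pow, Real.sq_sqrt (by positivity), mul_div_assoc', mul_div_assoc',
      div_le_one hn'] at h
    exact h
  have h4 : 4 * (L ^ 2 * α ^ 2) ≤ 1 := by
    have h := pow_le_one₀ (n := 2) (by positivity) h2
    linarith [show (α * (2 * L)) ^ 2 = 4 * (L ^ 2 * α ^ 2) by ring]
  rw [mul_div_assoc', le_div_iff₀ (by positivity)]
  -- The sum of L² · (α²σ²K ≤ n) and n/4 · (4L²α² ≤ 1).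
  nlinarith [mul_le_mul_of_nonneg_left h3 (sq_nonneg L), mul_le_mul_of_nonneg_right h4 hn'.le]

theorem sqrt_div_div_eq (hn : 0 < n) (hK : 0 < K) :
    Real.sqrt (K / n) / K = 1 / Real.sqrt (n * K) := by
  have hn' : (0 : ℝ) < n := by exact_mod_cast hn
  have hK' : (0 : ℝ) < K := by exact_mod_cast hK
  rw [Real.sqrt_div hK'.le, Real.sqrt_mul hn'.le]
  have h1 := Real.mul_self_sqrt hK'.le
  have : 0 < Real.sqrt n := Real.sqrt_pos.2 hn'
  have : 0 < Real.sqrt K := Real.sqrt_pos.2 hK'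
  field_simp
  nlinarith

theorem rate_le (hn : 0 < n) (hK : 0 < K) (hσ : 0 ≤ σ) (hL : 0 < L) {d : ℕ} {Δ Δ' G D S α : ℝ}
    (hα : α = stepSize n K σ L) (hΔ : Δ' ≤ Δ)
    (hS : α / 2 * S ≤ Δ' + K * (α / 2 * (L ^ 2 * (d * (α * G * D) ^ 2))
      + L / 2 * α ^ 2 * (σ ^ 2 / n))) :
    1 / (K : ℝ) * S ≤ (L + 2 * |Δ| + 4 * L * |Δ| + (L ^ 2 + 1 / 4) * D ^ 2)
      * (1 / (K : ℝ) + σ / Real.sqrt (n * K) + σ ^ 2 * n / (σ ^ 2 * K + n)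
        + G ^ 2 * d * n / (σ ^ 2 * K + n)) := by
  have hn' : (0 : ℝ) < n := by exact_mod_cast hn
  have hK' : (0 : ℝ) < K := by exact_mod_cast hK
  have hα0 : 0 < α := hα ▸ stepSize_pos hσ hL
  have h2 : L ^ 2 * α ^ 2 ≤ _ := hα ▸ sq_mul_stepSize_sq_le (K := K) hn hσ hL
  obtain ⟨h1, -⟩ := stepSize_mul_le (n := n) (K := K) hσ hL
  rw [← hα] at h1
  have hsq := sqrt_div_div_eq hn hK
  set t1 := 1 / (K : ℝ) with ht1
  set t2 := σ / Real.sqrt (n * K) with ht2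
  set t3 := σ ^ 2 * n / (σ ^ 2 * K + n) with ht3
  set t4 := G ^ 2 * d * n / (σ ^ 2 * K + n) with ht4
  have p1 : 0 ≤ t1 := by positivity
  have p2 : 0 ≤ t2 := by positivity
  have p3 : 0 ≤ t3 := by positivity
  have p4 : 0 ≤ t4 := by positivity
  have e1 : 1 / α = σ * Real.sqrt (K / n) + 2 * L := by rw [hα, stepSize, one_div_one_div]
  -- Multiplication by 2/(αK), with 1/α = σ√(K/n) + 2L substituted in the initial-gap term.
  have hmain : t1 * S ≤ 2 * Δ * (t2 + 2 * L * t1) + L ^ 2 * α ^ 2 * (d * G ^ 2) * D ^ 2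
      + L * (α * σ ^ 2 / n) := by
    have h := mul_le_mul_of_nonneg_left (hS.trans (add_le_add_left hΔ _))
      (show 0 ≤ 2 * (1 / α) * t1 by positivity)
    have l : 2 * (1 / α) * t1 * (α / 2 * S) = t1 * S := by field_simp
    have r : 2 * (1 / α) * t1 * (Δ + K * (α / 2 * (L ^ 2 * (d * (α * G * D) ^ 2))
        + L / 2 * α ^ 2 * (σ ^ 2 / n)))
        = 2 * Δ * (1 / α * t1) + L ^ 2 * α ^ 2 * (d * G ^ 2) * D ^ 2 + L * (α * σ ^ 2 / n) := by
      rw [ht1]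
      field_simp
      ring
    have e2 : 1 / α * t1 = t2 + 2 * L * t1 := by
      rw [e1, add_mul, mul_assoc, ht1, mul_one_div, hsq, mul_one_div]
    rw [l, r, e2] at h
    exact h
  have b1 : 2 * Δ * (t2 + 2 * L * t1) ≤ (2 * |Δ|) * t2 + (4 * L * |Δ|) * t1 := by
    have := mul_le_mul_of_nonneg_right (le_abs_self Δ)
      (show 0 ≤ 2 * (t2 + 2 * L * t1) by positivity)
    linarith
  have b2 : L ^ 2 * α ^ 2 * (d * G ^ 2) * D ^ 2 ≤ ((L ^ 2 + 1 / 4) * D ^ 2) * t4 := by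
    have e : ((L ^ 2 + 1 / 4) * D ^ 2) * t4
        = (L ^ 2 + 1 / 4) * (n / (σ ^ 2 * K + n)) * (d * G ^ 2) * D ^ 2 := by
      rw [ht4]
      ring
    rw [e]
    gcongr
  have b3 : L * (α * σ ^ 2 / n) ≤ L * t2 := by
    refine mul_le_mul_of_nonneg_left ?_ hL.le
    have h5 : Real.sqrt (K / n) * n = Real.sqrt (n * K) := by
      have : (n : ℝ) * K = K / n * n ^ 2 := by field_simp
      rw [this, Real.sqrt_mul (by positivity), Real.sqrt_sq hn'.le]
    have h6 : 0 < Real.sqrt (n * K) := Real.sqrt_pos.2 (by positivity)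
    rw [ht2, div_le_div_iff₀ hn' h6, ← h5]
    nlinarith [mul_le_mul_of_nonneg_left h1 (mul_nonneg hσ hn'.le)]
  have q1 : 0 ≤ 2 * |Δ| := by positivity
  have q2 : 0 ≤ 4 * L * |Δ| := by positivity
  have q3 : 0 ≤ (L ^ 2 + 1 / 4) * D ^ 2 := by positivity
  generalize 2 * |Δ| = c1 at *
  generalize 4 * L * |Δ| = c2 at *
  generalize (L ^ 2 + 1 / 4) * D ^ 2 = c3 at *
  have hexp : (L + c1 + c2 + c3) * (t1 + t2 + t3 + t4)
      = L * t1 + L * t2 + L * t3 + L * t4 + c1 * t1 + c1 * t2 + c1 * t3 + c1 * t4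
        + c2 * t1 + c2 * t2 + c2 * t3 + c2 * t4 + c3 * t1 + c3 * t2 + c3 * t3 + c3 * t4 := by
    ring
  rw [hexp]
  have := mul_nonneg hL.le p1
  have := mul_nonneg hL.le p3
  have := mul_nonneg hL.le p4
  have := mul_nonneg q1 p1
  have := mul_nonneg q1 p3
  have := mul_nonneg q1 p4
  have := mul_nonneg q2 p2
  have := mul_nonneg q2 p3
  have := mul_nonneg q2 p4
  have := mul_nonneg q3 p1
  have := mul_nonneg q3 p2
  have := mul_nonneg q3 p3
  linarith

end Rate

/-! ### Almost sure bounds along the random trajectory -/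

section RandomTrajectory

variable {n d : ℕ} {lam2 lamn α G δ θ : ℝ} {W : Matrix (Fin n) (Fin n) ℝ}

/-- The average moves by at most α√(dG²) per step. The crude growth in k is harmless: the bound
serves integrability only. -/
theorem norm_average_trajectory_le (h : IsTuned n lam2 lamn α G δ θ) (hW : W.IsSymm)
    (hds : W ∈ doublyStochastic ℝ (Fin n)) (hl2 : sortedEigenvalue hW ⟨1, h.two_le⟩ = lam2)
    (hln : sortedEigenvalue hW ⟨n - 1, Nat.sub_one_lt_of_lt h.two_le⟩ = lamn)
    {x γ : ℕ → Fin n → Model d} {q : ℕ → Fin n → Model d → Model d}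
    (hq : ∀ k i, IsQuantizer δ (q k i)) (hx0 : x 0 = 0)
    (hx : ∀ k, x (k + 1) = communicate W (modulus θ δ) (q k) (intermediate α x γ k))
    {K : ℕ} (hγ : ∀ k < K, ∀ i c, |γ k i c| ≤ G) :
    ∀ k ≤ K, ‖average (x k)‖ ≤ k * (α * Real.sqrt (d * G ^ 2))
  | 0, _ => by simp [hx0, average]
  | k + 1, hk => by
    have ih := norm_average_trajectory_le h hW hds hl2 hln hq hx0 hx hγ k (by omega)
    have hn : 0 < n := by linarith [h.two_le]
    have hγk := norm_average_le hn fun i => norm_le_of_abs_le (hγ k (by omega) i)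
    rw [average_succ h hW hds hl2 hln hq hx0 hx hγ (by omega)]
    refine (norm_sub_le _ _).trans ?_
    rw [norm_smul, Real.norm_eq_abs, abs_of_pos h.step_pos]
    have := mul_le_mul_of_nonneg_left hγk h.step_pos.le
    push_cast
    linarith

theorem norm_trajectory_le (h : IsTuned n lam2 lamn α G δ θ) (hW : W.IsSymm)
    (hds : W ∈ doublyStochastic ℝ (Fin n)) (hl2 : sortedEigenvalue hW ⟨1, h.two_le⟩ = lam2)
    (hln : sortedEigenvalue hW ⟨n - 1, Nat.sub_one_lt_of_lt h.two_le⟩ = lamn)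
    {x γ : ℕ → Fin n → Model d} {q : ℕ → Fin n → Model d → Model d}
    (hq : ∀ k i, IsQuantizer δ (q k i)) (hx0 : x 0 = 0)
    (hx : ∀ k, x (k + 1) = communicate W (modulus θ δ) (q k) (intermediate α x γ k))
    {K : ℕ} (hγ : ∀ k < K, ∀ i c, |γ k i c| ≤ G) {k : ℕ} (hk : k ≤ K) (i : Fin n) :
    ‖x k i‖ ≤ Real.sqrt (n * (d * (α * G * (6 * D₁ lam2 lamn + 2)) ^ 2))
      + k * (α * Real.sqrt (d * G ^ 2)) := by
  have h1 := norm_average_trajectory_le h hW hds hl2 hln hq hx0 hx hγ k hk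
  have h2 : ‖x k i - average (x k)‖ ^ 2 ≤ _ :=
    (Finset.single_le_sum (f := fun i => ‖x k i - average (x k)‖ ^ 2)
      (fun _ _ => sq_nonneg _) (Finset.mem_univ i)).trans
      (sum_norm_sub_average_sq_le h hW hds hl2 hln hq hx0 hx hγ hk)
  have h3 := Real.le_sqrt_of_sq_le h2
  have h4 := norm_add_le (x k i - average (x k)) (average (x k))
  rw [sub_add_cancel] at h4
  linarith

end RandomTrajectory

end MoniquaD2

theorem mainTheorem1 (L Δ lam2 lamn : ℝ) (hL : 0 < L) (hlam2 : lam2 < 1)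
    (hlamn : -(1 / 3) < lamn) :
    ∃ C : ℝ, 0 < C ∧
      ∀ (n d K : ℕ) (hn : 2 ≤ n) (_hK : 1 ≤ K)
        (W : Matrix (Fin n) (Fin n) ℝ) (hW : W.IsSymm)
        (_hWds : W ∈ doublyStochastic ℝ (Fin n))
        (_hW2 : MoniquaD2.sortedEigenvalue hW ⟨1, by omega⟩ = lam2)
        (_hWn : MoniquaD2.sortedEigenvalue hW ⟨n - 1, by omega⟩ = lamn)
        (σ G : ℝ) (_hσ : 0 ≤ σ) (_hG : 0 < G)
        (f : Fin n → MoniquaD2.Model d → ℝ)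
        (_hf : ∀ i, MoniquaD2.IsSmooth L (f i))
        (_hbdd : BddBelow (Set.range (MoniquaD2.objective f)))
        (_hΔ : MoniquaD2.objective f 0 - ⨅ x, MoniquaD2.objective f x ≤ Δ)
        (Ω Ξ U : Type*) [MeasurableSpace Ω] [MeasurableSpace Ξ] [MeasurableSpace U]
        (P : MeasureTheory.Measure Ω) [MeasureTheory.IsProbabilityMeasure P]
        (D : Fin n → MeasureTheory.Measure Ξ)
        (g : Fin n → MoniquaD2.Model d → Ξ → MoniquaD2.Model d)
        (_hg : ∀ i, MoniquaD2.IsStochasticGradient (D i) σ (f i) (g i))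
        (ξ : ℕ → Fin n → Ω → Ξ) (u : ℕ → Fin n → Ω → U)
        (_hs : MoniquaD2.IsSampling P D ξ u)
        (Q : U → MoniquaD2.Model d → MoniquaD2.Model d)
        (_hQm : Measurable fun p : U × MoniquaD2.Model d => Q p.1 p.2)
        (δ α θ : ℝ)
        (_hδ : δ = MoniquaD2.accuracy n lam2 lamn)
        (_hα : α = MoniquaD2.stepSize n K σ L)
        (_hθ : θ = MoniquaD2.theta n lam2 lamn α G)
        (_hQ : ∀ v, MoniquaD2.IsQuantizer δ (Q v))
        (x : ℕ → Fin n → Ω → MoniquaD2.Model d)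
        (_hx : ∀ k i ω, x k i ω =
          MoniquaD2.iterates W (MoniquaD2.modulus θ δ) α g Q
            (fun t j => ξ t j ω) (fun t j => u t j ω) k i)
        (_hbound : ∀ k < K, ∀ i, ∀ᵐ ω ∂P, ∀ c, |g i (x k i ω) (ξ k i ω) c| ≤ G),
        (∀ k < K, MeasureTheory.Integrable
          (fun ω => ‖gradient (MoniquaD2.objective f)
            (MoniquaD2.average fun i => x k i ω)‖ ^ 2) P) ∧
        (1 / (K : ℝ)) * ∑ k ∈ Finset.range K,
            ∫ ω, ‖gradient (MoniquaD2.objective f)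
              (MoniquaD2.average fun i => x k i ω)‖ ^ 2 ∂P
          ≤ C * (1 / (K : ℝ) + σ / Real.sqrt (n * K)
              + σ ^ 2 * n / (σ ^ 2 * K + n)
              + G ^ 2 * d * n / (σ ^ 2 * K + n)) := by
  refine ⟨L + 2 * |Δ| + 4 * L * |Δ| + (L ^ 2 + 1 / 4) * (6 * MoniquaD2.D₁ lam2 lamn + 2) ^ 2,
    by positivity, ?_⟩
  intro n d K hn hK W hW hds hW2 hWn σ G hσ hG f hf hbdd hΔ Ω Ξ U _ _ _ P _ D g hg ξ u hs Q hQm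
    δ α θ hδ hα hθ hQ x hx hbound
  have hn0 : 0 < n := by omega
  have hle : lamn ≤ lam2 := by
    rw [← hW2, ← hWn]
    exact MoniquaD2.sortedEigenvalue_antitone hW
      (by rw [Fin.le_def]; change 1 ≤ n - 1; omega)
  have hα0 : 0 < α := hα ▸ MoniquaD2.stepSize_pos hσ hL
  have hαL : α * L ≤ 1 := by
    have : α * (2 * L) ≤ 1 := hα ▸ (MoniquaD2.stepSize_mul_le hσ hL).2
    nlinarith [mul_pos hα0 hL]
  have ht : MoniquaD2.IsTuned n lam2 lamn α G δ θ :=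
    ⟨hn, hlam2, hlamn, hle, hα0, hG, hδ, hθ⟩
  have hgood : ∀ᵐ ω ∂P, ∀ k < K, ∀ i c, |g i (x k i ω) (ξ k i ω) c| ≤ G :=
    ae_all_iff.2 fun k => ae_all_iff.2 fun hk => ae_all_iff.2 fun i => hbound k hk i
  have hx0 : ∀ ω, (fun i => x 0 i ω) = 0 := fun ω => funext fun i => hx 0 i ω
  have hxfun : ∀ ω k, (fun i => x k i ω) = MoniquaD2.iterates W (MoniquaD2.modulus θ δ) α g Q
      (fun t j => ξ t j ω) (fun t j => u t j ω) k := fun ω k => funext fun i => hx k i ω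
  have hxs : ∀ ω k, (fun i => x (k + 1) i ω) = MoniquaD2.communicate W (MoniquaD2.modulus θ δ)
      (fun i => Q (u k i ω)) (MoniquaD2.intermediate α (fun k i => x k i ω)
        (fun k i => g i (x k i ω) (ξ k i ω)) k) := by
    intro ω k
    have e : (fun k i => x k i ω) = MoniquaD2.iterates W (MoniquaD2.modulus θ δ) α g Q
      (fun t j => ξ t j ω) (fun t j => u t j ω) := funext (hxfun ω)
    rw [hxfun, MoniquaD2.iterates_succ, ← e]
  have hmeas : ∀ k i, Measurable (x k i) := fun k i => by
    rw [show x k i = _ from funext (hx k i)]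
    exact MoniquaD2.measurable_iterates W _ α (fun i => (hg i).measurable) hQm
      (fun t i => hs.measurable_data t i) (fun t i => hs.measurable_seed t i) k i
  have hγm : ∀ k i, Measurable fun ω => g i (x k i ω) (ξ k i ω) := fun k i =>
    (hg i).measurable.comp ((hmeas k i).prodMk (hs.measurable_data k i))
  -- The consensus results are deterministic; they are applied to each realization whose sampled
  -- gradients obey the bound.
  have hpath : ∀ᵐ ω ∂P,
      (∀ k ≤ K, ∀ i, ‖x k i ω‖ ≤ Real.sqrt (n * (d * (α * G * (6 * MoniquaD2.D₁ lam2 lamn + 2)) ^ 2))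
        + k * (α * Real.sqrt (d * G ^ 2))) ∧
      (∀ k ≤ K, ∑ i, ‖x k i ω - MoniquaD2.average fun j => x k j ω‖ ^ 2
        ≤ n * (d * (α * G * (6 * MoniquaD2.D₁ lam2 lamn + 2)) ^ 2)) ∧
      ∀ k < K, (MoniquaD2.average fun i => x (k + 1) i ω)
        = (MoniquaD2.average fun i => x k i ω)
          - α • MoniquaD2.average fun i => g i (x k i ω) (ξ k i ω) := by
    filter_upwards [hgood] with ω hω
    have hq : ∀ k i, MoniquaD2.IsQuantizer δ (Q (u k i ω)) := fun k i => hQ _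
    exact ⟨fun k hk i => MoniquaD2.norm_trajectory_le ht hW hds hW2 hWn hq
        (x := fun k i => x k i ω) (γ := fun k i => g i (x k i ω) (ξ k i ω))
        (hx0 ω) (hxs ω) hω hk i,
      fun k hk => MoniquaD2.sum_norm_sub_average_sq_le ht hW hds hW2 hWn hq
        (x := fun k i => x k i ω) (γ := fun k i => g i (x k i ω) (ξ k i ω))
        (hx0 ω) (hxs ω) hω hk,
      fun k hk => MoniquaD2.average_succ ht hW hds hW2 hWn hq
        (x := fun k i => x k i ω) (γ := fun k i => g i (x k i ω) (ξ k i ω))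
        (hx0 ω) (hxs ω) hω hk⟩
  have hxb : ∀ k ≤ K, ∀ i, MoniquaD2.IsEssBounded P (x k i) := fun k hk i =>
    ⟨hmeas k i, _, hpath.mono fun ω hω => hω.1 k hk i⟩
  have hγb : ∀ k < K, ∀ i, MoniquaD2.IsEssBounded P fun ω => g i (x k i ω) (ξ k i ω) :=
    fun k hk i => by
      refine ⟨hγm k i, Real.sqrt (d * G ^ 2), ?_⟩
      filter_upwards [hgood] with ω hω
      exact MoniquaD2.norm_le_of_abs_le (hω k hk i)
  have hF := MoniquaD2.IsSmooth.objective hn0 hf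
  have hav : ∀ k ≤ K, MoniquaD2.IsEssBounded P fun ω => MoniquaD2.average fun i => x k i ω :=
    fun k hk => MoniquaD2.IsEssBounded.average (hxb k hk)
  have hint : ∀ k < K, Integrable (fun ω => ‖gradient (MoniquaD2.objective f)
      (MoniquaD2.average fun i => x k i ω)‖ ^ 2) P := fun k hk =>
    ((hav k hk.le).continuous_comp hF.continuous_gradient).norm_sq.integrable
  refine ⟨hint, ?_⟩
  have hstep : ∀ k < K, ∫ ω, MoniquaD2.objective f (MoniquaD2.average fun i => x (k + 1) i ω) ∂P
      ≤ ∫ ω, MoniquaD2.objective f (MoniquaD2.average fun i => x k i ω) ∂P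
        - α / 2 * ∫ ω, ‖gradient (MoniquaD2.objective f)
          (MoniquaD2.average fun i => x k i ω)‖ ^ 2 ∂P
        + (α / 2 * (L ^ 2 * (d * (α * G * (6 * MoniquaD2.D₁ lam2 lamn + 2)) ^ 2))
          + L / 2 * α ^ 2 * (σ ^ 2 / n)) := by
    intro k hk
    have hi : IndepFun (fun ω i => x k i ω) (fun ω i => ξ k i ω) P := by
      rw [show (fun ω i => x k i ω) = _ from funext fun ω => hxfun ω k]
      exact hs.indepFun_iterates W _ α (fun i => (hg i).measurable) hQm k
    rw [← add_assoc]
    refine MoniquaD2.integral_objective_step_le hn0 hg hf (hxb k hk.le) (hs.measurable_data k)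
      (hs.law k) hi (hs.indep_workers k) (hγb k hk) hα0 hL.le hαL
      (hpath.mono fun ω hω => hω.2.1 k hk.le) (hav (k + 1) hk)
      (hpath.mono fun ω hω => hω.2.2 k hk)
  have hsum := MoniquaD2.mul_sum_le_of_descent
    (b := fun k => ∫ ω, MoniquaD2.objective f (MoniquaD2.average fun i => x k i ω) ∂P) K hstep
  refine MoniquaD2.rate_le hn0 hK hσ hL hα ?_ hsum
  have h0 : ∫ ω, MoniquaD2.objective f (MoniquaD2.average fun i => x 0 i ω) ∂P
      = MoniquaD2.objective f 0 := by
    have e : ∀ ω, (MoniquaD2.average fun i => x 0 i ω) = 0 := fun ω => by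
      rw [hx0 ω]
      simp [MoniquaD2.average]
    simp only [e, integral_const, probReal_univ, one_smul]
  -- After telescoping, the final expected objective is bounded below by the infimum.
  have hK' : ⨅ y, MoniquaD2.objective f y
      ≤ ∫ ω, MoniquaD2.objective f (MoniquaD2.average fun i => x K i ω) ∂P := by
    have h := integral_mono (integrable_const (⨅ y, MoniquaD2.objective f y))
      ((hav K le_rfl).continuous_comp hF.1.continuous).integrable
      (fun ω => ciInf_le hbdd (MoniquaD2.average fun i => x K i ω))
    simpa only [integral_const, probReal_univ, one_smul] using h
  rw [h0]
  linarith
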